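/- Let $m\ge 0$ and let $n$ be a positive integer. An $m$-component virtual string link diagram is a diagram of $m$ ordered, oriented strands with classical and virtual crossings; up to planar isotopy and the virtual moves V1–V4 it is the same thing as its Gauss diagram, that is, the list, for each strand, of the classical crossings met along it, each marked as over- or underpass and with the sign of the crossing, and it is recorded by this Gauss diagram. A welded string link is an equivalence class of such diagrams under the Reidemeister moves R1–R3 (in all orientations), the virtual moves V1–V4 and the overcrossings-commute move OC. A $V^n$-move replaces two parallel pieces of strands without crossings by two pieces which form $n$ consecutive classical crossings of the same sign, at all of which the same strand passes over the other one, with a virtual crossing after each of them. A self-crossing virtualization replaces a classical crossing of a component with itself by a virtual one. The $(V^n+\mathrm{sv})$-equivalence is the equivalence relation on welded string links generated by $V^n$-moves and self-crossing virtualizations. Let $D$ be a diagram of a welded string link $\sigma$. Let $a_{i1},\dots,a_{ir(i)}$ be the arcs of the $i$th component in order (separated by its classical underpasses), and let $u_{ij}=b^{\varepsilon}$, where $b$ is the arc that passes over at the end of $a_{ij}$ and $\varepsilon=\pm1$ is the sign of the crossing. Let $$G=\langle a_{ij}\mid a_{i\,j+1}^{-1}u_{ij}^{-1}a_{ij}u_{ij}\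 (1\le i\le m,\ 1\le j<r(i))\rangle ,$$ with lower central series $G=G_1\supseteq G_2\supseteq\cdots$. The $i$th preferred longitude is $l_i=a_{i1}^{s}u_{i1}u_{i2}\cdots u_{i\,r(i)-1}$, where $s\in\mathbb Z$ makes the total exponent of the arcs of the $i$th component zero. For a sequence $I=j_1\dots j_k i$ in $\{1,\dots,m\}$ choose $q>k$ and an element $\lambda_i$ of the free group on $\alpha_1,\dots,\alpha_m$ whose image under $\alpha_j\mapsto a_{j1}$ equals $l_i$ modulo $G_q$. The welded Milnor invariant $\mu^{\mathrm w}_\sigma(I)\in\mathbb Z$ is the coefficient of $X_{j_1}\cdots X_{j_k}$ in the Magnus expansion $E(\lambda_i)\in\mathbb Z\langle\langle X_1,\dots,X_m\rangle\rangle$, where $E(\alpha_j)=1+X_j$. **Theorem.** If two $m$-component welded string links $\sigma$ and $\sigma'$ are $(V^n+\mathrm{sv})$-equivalent, then for every non-repeated sequence $I$ (a nonempty sequence of pairwise distinct elements of $\{1,\dots,m\}$) the integers $\mu^{\mathrm w}_\sigma(I)$ and $\mu^{\mathrm w}_{\sigma'}(I)$ are well defined (suitable $D$, $q$, $\lambda_i$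 exist, and the value does not depend on their choice) and $$\mu^{\mathrm w}_{\sigma}(I)\equiv\mu^{\mathrm w}_{\sigma'}(I)\pmod n .$$ -/

import Mathlib

/-! ## Gauss diagrams of virtual string links -/

/-- One endpoint of an arrow of a Gauss diagram, i.e. one passage of a strand through a classical
crossing: the name of the crossing, whether the strand passes over (`true`) or under (`false`),
and the sign of the crossing. -/
@[ext] structure Letter where
  crossing : ℕ
  isOver : Bool
  sign : ℤˣ
deriving DecidableEq

/-- The overpass of the crossing `c` of sign `ε`. -/
def Letter.over (c : ℕ) (ε : ℤˣ) : Letter := ⟨c, true, ε⟩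

/-- The underpass of the crossing `c` of sign `ε`. -/
def Letter.under (c : ℕ) (ε : ℤˣ) : Letter := ⟨c, false, ε⟩

/-- The other passage through the same crossing. -/
def Letter.mate (x : Letter) : Letter := ⟨x.crossing, !x.isOver, x.sign⟩

/-- Renaming of crossings. -/
def Letter.rename (f : ℕ → ℕ) (x : Letter) : Letter := ⟨f x.crossing, x.isOver, x.sign⟩

/-- All letters met on the `m` components, one component after the other. -/
def allLetters {m : ℕ} {α : Type*} (w : Fin m → List α) : List α :=
  (List.finRange m).flatMap w

/-- A virtual string link diagram with `m` ordered oriented components, recorded by its Gauss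
diagram: `word i` lists the classical crossings met along the `i`th component from its initial to
its terminal point. Every crossing that occurs is passed exactly twice, once over and once under.
Virtual crossings leave no trace: two virtual diagrams have the same Gauss diagram exactly when
they are related by planar isotopy and the virtual moves V1-V4, and every Gauss diagram comes from
a virtual diagram. -/
structure GaussDiagram (m : ℕ) where
  word : Fin m → List Letter
  nodup : (allLetters word).Nodup
  mate_mem : ∀ x ∈ allLetters word, x.mate ∈ allLetters word
  sign_eq : ∀ x ∈ allLetters word, ∀ y ∈ allLetters word,
    x.crossing = y.crossing → x.sign = y.sign

/-- `W` is a diagram outside a disk `Δ` that meets `k` strands: the hole `Sum.inr j` stands for the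
`j`th strand inside `Δ`. `fillHoles W B` puts the word `B j` on the `j`th strand. -/
def fillHoles {m k : ℕ} (W : Fin m → List (Letter ⊕ Fin k)) (B : Fin k → List Letter) :
    Fin m → List Letter :=
  fun i => (W i).flatMap (Sum.elim (fun x => [x]) B)

/-- `D` and `E` agree outside a disk `Δ` that meets `k` distinct pieces of strands, and read
`B` and `C` inside. -/
def LocalMove {m k : ℕ} (B C : Fin k → List Letter) (D E : GaussDiagram m) : Prop :=
  ∃ W : Fin m → List (Letter ⊕ Fin k),
    (∀ j : Fin k, (allLetters W).count (Sum.inr j) = 1) ∧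
      D.word = fillHoles W B ∧ E.word = fillHoles W C

/-- The two letters `x`, `y` in this order if `s = 1`, in the opposite order if `s = -1`. -/
def pairInOrder (s : ℤˣ) (x y : Letter) : List Letter :=
  if s = 1 then [x, y] else [y, x]

/-- The welded Reidemeister moves (the virtual moves V1-V4 do not change a Gauss diagram).

* `r1`: a kink, with either sign, passed over first or under first.
* `r2`: one strand runs over another at two crossings of opposite signs; the strands are parallel
  (`s = 1`) or antiparallel (`s = -1`).
* `r3`: a top, a middle and a bottom strand cross pairwise, top/middle at `a`, top/bottom at `b`,
  middle/bottom at `c`. The move reverses the order of the two crossings on each strand. For strands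
  with directions `t`, `u`, `v`, the triangle `a b c` gives `τ|ab| t + β|bc| v = μ|ac| u`, where
  `τ`, `μ`, `β` say in which order the crossings are met on the top, middle and bottom strand; hence
  the signs of `a`, `b`, `c` are proportional to `β`, `μ`, `τ`. The eight choices of
  `δ, τ, μ, β` up to a common change of sign are the eight oriented moves R3.
* `oc`: two consecutive overpasses are exchanged. -/
inductive WeldedMove {m : ℕ} : GaussDiagram m → GaussDiagram m → Prop
  | rename (D E : GaussDiagram m) (f : Equiv.Perm ℕ)
      (h : ∀ i, E.word i = (D.word i).map (Letter.rename f)) : WeldedMove D E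
  | r1 (D E : GaussDiagram m) (c : ℕ) (ε s : ℤˣ)
      (h : LocalMove ![[]] ![pairInOrder s (Letter.over c ε) (Letter.under c ε)] D E) :
      WeldedMove D E
  | r2 (D E : GaussDiagram m) (c d : ℕ) (ε s : ℤˣ)
      (h : LocalMove ![[], []]
        ![[Letter.over c ε, Letter.over d (-ε)],
          pairInOrder s (Letter.under c ε) (Letter.under d (-ε))] D E) :
      WeldedMove D E
  | r3 (D E : GaussDiagram m) (a b c : ℕ) (δ τ μ β : ℤˣ)
      (h : LocalMove
        ![pairInOrder τ (Letter.over a (δ * β)) (Letter.over b (δ * μ)),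
          pairInOrder μ (Letter.under a (δ * β)) (Letter.over c (δ * τ)),
          pairInOrder β (Letter.under b (δ * μ)) (Letter.under c (δ * τ))]
        ![pairInOrder (-τ) (Letter.over a (δ * β)) (Letter.over b (δ * μ)),
          pairInOrder (-μ) (Letter.under a (δ * β)) (Letter.over c (δ * τ)),
          pairInOrder (-β) (Letter.under b (δ * μ)) (Letter.under c (δ * τ))] D E) :
      WeldedMove D E
  | oc (D E : GaussDiagram m) (c d : ℕ) (ε ε' : ℤˣ)
      (h : LocalMove ![[Letter.over c ε, Letter.over d ε']]
        ![[Letter.over d ε', Letter.over c ε]] D E) : WeldedMove D E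

/-- Welded string links with `m` components: diagrams modulo the equivalence relation generated by
the welded Reidemeister moves. -/
def WeldedStringLink (m : ℕ) : Type := Quot (WeldedMove (m := m))

/-- The welded string link of a diagram. -/
def GaussDiagram.toLink {m : ℕ} (D : GaussDiagram m) : WeldedStringLink m :=
  Quot.mk _ D

/-- Self-crossing virtualization: a classical crossing `c` of a component with itself becomes
virtual, i.e. its two passages, both on the component `i`, disappear from the Gauss diagram. -/
def SelfVirtualization {m : ℕ} (D E : GaussDiagram m) : Prop :=
  ∃ (i : Fin m) (c : ℕ) (ε : ℤˣ),
    Letter.over c ε ∈ D.word i ∧ Letter.under c ε ∈ D.word i ∧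
      ∀ j, E.word j = (D.word j).filter (fun x => x.crossing ≠ c)

/-- The `V^n`-move: two parallel pieces of strands without crossings are replaced by two strands
with `n` classical crossings of the same sign `ε`, at all of which the first one passes over the
second one. (The strands return to their former side by a virtual crossing after each classical
one.) -/
def VMove {m : ℕ} (n : ℕ) (D E : GaussDiagram m) : Prop :=
  ∃ (c : Fin n → ℕ) (ε : ℤˣ),
    LocalMove ![[], []]
      ![List.ofFn (fun t => Letter.over (c t) ε), List.ofFn (fun t => Letter.under (c t) ε)] D E

/-- `(V^n + sv)`-equivalence of welded string links: the equivalence relation generated by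
`V^n`-moves and self-crossing virtualizations of diagrams that represent them. -/
def VnSvEquiv {m : ℕ} (n : ℕ) : WeldedStringLink m → WeldedStringLink m → Prop :=
  Relation.EqvGen fun σ σ' => ∃ D E : GaussDiagram m,
    D.toLink = σ ∧ E.toLink = σ' ∧ (VMove n D E ∨ SelfVirtualization D E)

/-! ## The group of a diagram and its longitudes -/

namespace GaussDiagram

variable {m : ℕ}

/-- The underpasses on the `i`th component, in order. -/
def underpasses (D : GaussDiagram m) (i : Fin m) : List Letter :=
  (D.word i).filter (fun x => !x.isOver)

/-- The arcs of the diagram. `⟨i, j⟩` is the arc of the `i`th component that begins after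
exactly `j` underpasses (so the count starts at `0`). -/
abbrev Arc (D : GaussDiagram m) : Type :=
  Σ i : Fin m, Fin ((D.underpasses i).length + 1)

/-- The overpass of the crossing `c` lies on the arc `a`. -/
def IsOverArc (D : GaussDiagram m) (c : ℕ) (a : D.Arc) : Prop :=
  ∃ (ε : ℤˣ) (pre post : List Letter),
    D.word a.1 = pre ++ Letter.over c ε :: post ∧
      (pre.filter (fun x => !x.isOver)).length = (a.2 : ℕ)

/-- Each crossing that is passed under has an arc that passes over. -/
theorem exists_isOverArc (D : GaussDiagram m) (i : Fin m) (x : Letter)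
    (hx : x ∈ D.underpasses i) : ∃ a : D.Arc, D.IsOverArc x.crossing a := by
  obtain ⟨hx1, hx2⟩ := List.mem_filter.1 hx
  have h1 : x ∈ allLetters D.word := List.mem_flatMap.2 ⟨i, List.mem_finRange i, hx1⟩
  obtain ⟨j, -, hj⟩ := List.mem_flatMap.1 (D.mate_mem x h1)
  obtain ⟨pre, post, h⟩ := List.append_of_mem hj
  have hm : x.mate = Letter.over x.crossing x.sign := by
    simp only [Letter.mate, Letter.over]
    rw [hx2]
  refine ⟨⟨j, ⟨(pre.filter (fun x => !x.isOver)).length, ?_⟩⟩, x.sign, pre, post, ?_, rfl⟩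
  · simp [underpasses, h]
  · rw [h, hm]

/-- The arc that passes over at the `j`th underpass of the `i`th component. -/
noncomputable def overArc (D : GaussDiagram m) (i : Fin m)
    (j : Fin (D.underpasses i).length) : D.Arc :=
  (D.exists_isOverArc i ((D.underpasses i).get j) (List.get_mem _ _)).choose

/-- The element `u i j`: the generator of the arc that passes over at the `j`th underpass of the
`i`th component, with the sign of the crossing as its exponent. -/
noncomputable def conjugator (D : GaussDiagram m) (i : Fin m)
    (j : Fin (D.underpasses i).length) : FreeGroup D.Arc :=
  FreeGroup.of (D.overArc i j) ^ ((((D.underpasses i).get j).sign : ℤˣ) : ℤ)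

/-- The Wirtinger relators. -/
def relators (D : GaussDiagram m) : Set (FreeGroup D.Arc) :=
  {r | ∃ (i : Fin m) (j : Fin (D.underpasses i).length),
    r = (FreeGroup.of (⟨i, j.succ⟩ : D.Arc))⁻¹ * (D.conjugator i j)⁻¹ *
      FreeGroup.of (⟨i, j.castSucc⟩ : D.Arc) * D.conjugator i j}

/-- The group `G(D)`, given by the Wirtinger presentation. -/
abbrev LinkGroup (D : GaussDiagram m) : Type := PresentedGroup D.relators

/-- The generator of the initial arc of the `i`th component. -/
def meridianGen (D : GaussDiagram m) (i : Fin m) : FreeGroup D.Arc :=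
  FreeGroup.of (⟨i, 0⟩ : D.Arc)

/-- The sum of the signs of the crossings of the `i`th component with itself. -/
def selfWrithe (D : GaussDiagram m) (i : Fin m) : ℤ :=
  (((D.underpasses i).filter (fun x => x.mate ∈ D.word i)).map
    (fun x => ((x.sign : ℤˣ) : ℤ))).sum

/-- The preferred longitude of the `i`th component as a word in the arcs: the product of the
`u i j` over all underpasses, multiplied on the left by the power of the meridian that makes the
total exponent of the arcs of the `i`th component zero. -/
noncomputable def longitude (D : GaussDiagram m) (i : Fin m) : FreeGroup D.Arc :=
  D.meridianGen i ^ (-D.selfWrithe i) * (List.ofFn (D.conjugator i)).prod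

/-- The word `w` in `α_1, …, α_m` expresses the `i`th preferred longitude modulo the `q`th term
`G_q` of the lower central series (`G_1 = G`, hence the shift of the index). -/
def IsLongitudeWord (D : GaussDiagram m) (i : Fin m) (q : ℕ) (w : FreeGroup (Fin m)) : Prop :=
  ((PresentedGroup.mk D.relators (FreeGroup.lift D.meridianGen w) : D.LinkGroup) :
      D.LinkGroup ⧸ (⊤ : Subgroup D.LinkGroup).lowerCentralSeries (q - 1)) =
    ((PresentedGroup.mk D.relators (D.longitude i) : D.LinkGroup) :
      D.LinkGroup ⧸ (⊤ : Subgroup D.LinkGroup).lowerCentralSeries (q - 1))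

end GaussDiagram

/-! ## Noncommutative power series and the Magnus expansion -/

/-- The formal power series with integer coefficients in the noncommuting variables
`X_1, …, X_m`; a series is given by its coefficients at the monomials `X_{j_1} ⋯ X_{j_k}`. -/
@[ext] structure NCSeries (m : ℕ) where
  coeff : List (Fin m) → ℤ

namespace NCSeries

variable {m : ℕ}

instance : Zero (NCSeries m) := ⟨⟨fun _ => 0⟩⟩
instance : One (NCSeries m) := ⟨⟨fun J => if J = [] then 1 else 0⟩⟩
instance : Add (NCSeries m) := ⟨fun f g => ⟨fun J => f.coeff J + g.coeff J⟩⟩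
instance : Neg (NCSeries m) := ⟨fun f => ⟨fun J => -f.coeff J⟩⟩

/-- The product of series: a sum over all ways to cut a monomial in two. -/
instance : Mul (NCSeries m) :=
  ⟨fun f g => ⟨fun J => ∑ k ∈ Finset.range (J.length + 1),
    f.coeff (J.take k) * g.coeff (J.drop k)⟩⟩

theorem coeff_zero (J : List (Fin m)) : (0 : NCSeries m).coeff J = 0 := rfl
theorem coeff_one (J : List (Fin m)) : (1 : NCSeries m).coeff J = if J = [] then 1 else 0 := rfl
theorem coeff_add (f g : NCSeries m) (J : List (Fin m)) :
    (f + g).coeff J = f.coeff J + g.coeff J := rfl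
theorem coeff_neg (f : NCSeries m) (J : List (Fin m)) : (-f).coeff J = -f.coeff J := rfl
theorem coeff_mul (f g : NCSeries m) (J : List (Fin m)) :
    (f * g).coeff J = ∑ k ∈ Finset.range (J.length + 1),
      f.coeff (J.take k) * g.coeff (J.drop k) := rfl

theorem coeff_mul_nil (f g : NCSeries m) : (f * g).coeff [] = f.coeff [] * g.coeff [] := by
  simp [coeff_mul]

/-- The series whose coefficient at `J` is the coefficient of `f` at `x :: J`. -/
def shift (x : Fin m) (f : NCSeries m) : NCSeries m := ⟨fun J => f.coeff (x :: J)⟩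

theorem coeff_mul_cons (f g : NCSeries m) (x : Fin m) (J : List (Fin m)) :
    (f * g).coeff (x :: J) = (shift x f * g).coeff J + f.coeff [] * g.coeff (x :: J) := by
  rw [coeff_mul, coeff_mul, List.length_cons, Finset.sum_range_succ']
  simp [shift]

theorem mul_assoc_coeff (J : List (Fin m)) : ∀ f g h : NCSeries m,
    (f * g * h).coeff J = (f * (g * h)).coeff J := by
  induction J with
  | nil => intro f g h; simp only [coeff_mul_nil, mul_assoc]
  | cons x J ih =>
    intro f g h
    have key : (shift x (f * g) * h).coeff J =
        (shift x f * g * h).coeff J + f.coeff [] * (shift x g * h).coeff J := by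
      simp only [coeff_mul (shift x (f * g)), coeff_mul (shift x f * g), coeff_mul (shift x g)]
      rw [Finset.mul_sum, ← Finset.sum_add_distrib]
      refine Finset.sum_congr rfl fun k _ => ?_
      have : (shift x (f * g)).coeff (J.take k) =
          (shift x f * g).coeff (J.take k) + f.coeff [] * (shift x g).coeff (J.take k) :=
        coeff_mul_cons f g x (J.take k)
      rw [this]
      ring
    rw [coeff_mul_cons, coeff_mul_cons, key, ih, coeff_mul_cons g h, coeff_mul_nil]
    ring

instance : Ring (NCSeries m) where
  add_assoc _ _ _ := NCSeries.ext (funext fun _ => add_assoc _ _ _)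
  zero_add _ := NCSeries.ext (funext fun _ => zero_add _)
  add_zero _ := NCSeries.ext (funext fun _ => add_zero _)
  add_comm _ _ := NCSeries.ext (funext fun _ => add_comm _ _)
  neg_add_cancel _ := NCSeries.ext (funext fun _ => neg_add_cancel _)
  nsmul := nsmulRec
  zsmul := zsmulRec
  mul_assoc f g h := NCSeries.ext (funext fun J => mul_assoc_coeff J f g h)
  zero_mul f := NCSeries.ext (funext fun J => by simp [coeff_mul, coeff_zero])
  mul_zero f := NCSeries.ext (funext fun J => by simp [coeff_mul, coeff_zero])
  left_distrib f g h := NCSeries.ext (funext fun J => by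
    simp only [coeff_mul, coeff_add, mul_add, Finset.sum_add_distrib])
  right_distrib f g h := NCSeries.ext (funext fun J => by
    simp only [coeff_mul, coeff_add, add_mul, Finset.sum_add_distrib])
  one_mul f := NCSeries.ext (funext fun J => by
    cases J with
    | nil => simp [coeff_mul_nil, coeff_one]
    | cons x J => simp [coeff_mul, coeff_one])
  mul_one f := NCSeries.ext (funext fun J => by
    induction J generalizing f with
    | nil => simp [coeff_mul_nil, coeff_one]
    | cons x J ih => rw [coeff_mul_cons, ih]; simp [coeff_one, shift])

/-- The variable `X_i`. -/
def var (i : Fin m) : NCSeries m := ⟨fun J => if J = [i] then 1 else 0⟩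

/-- The geometric series `1 - X_i + X_i ^ 2 - X_i ^ 3 + ⋯`. -/
def geom (i : Fin m) : NCSeries m :=
  ⟨fun J => if J = List.replicate J.length i then (-1) ^ J.length else 0⟩

theorem shift_geom (i x : Fin m) :
    shift x (geom i) = if x = i then -geom i else 0 := by
  ext J
  by_cases h : x = i
  · subst h
    by_cases hJ : J = List.replicate J.length x
    · simp [shift, geom, coeff_neg, List.replicate_succ, pow_succ, ← hJ]
    · simp [shift, geom, coeff_neg, List.replicate_succ, hJ]
  · simp [shift, geom, h, List.replicate_succ, coeff_zero]

theorem shift_one_add_var (i x : Fin m) :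
    shift x (1 + var i) = if x = i then 1 else 0 := by
  ext J
  by_cases h : x = i <;> simp [shift, var, coeff_add, coeff_one, coeff_zero, h]

theorem one_add_var_mul_geom (i : Fin m) : (1 + var i) * geom i = 1 := by
  ext J
  cases J with
  | nil => simp [coeff_mul_nil, coeff_add, coeff_one, var, geom]
  | cons x J =>
    rw [coeff_mul_cons, shift_one_add_var]
    have h := congrArg (fun f => f.coeff J) (shift_geom i x)
    simp only [shift] at h
    rw [h]
    by_cases hx : x = i <;> simp [hx, coeff_add, coeff_one, var, coeff_neg, coeff_zero]

theorem geom_mul_one_add_var (i : Fin m) : geom i * (1 + var i) = 1 := by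
  ext J
  induction J with
  | nil => simp [coeff_mul_nil, coeff_add, coeff_one, var, geom]
  | cons x J ih =>
    rw [coeff_mul_cons, shift_geom]
    by_cases hx : x = i
    · have h2 : (-geom i * (1 + var i)).coeff J = -((geom i * (1 + var i)).coeff J) := by
        rw [neg_mul, coeff_neg]
      rw [if_pos hx, h2, ih]
      by_cases hJ : J = [] <;> simp [hx, hJ, coeff_add, coeff_one, var, geom]
    · simp [hx, coeff_add, coeff_one, var, coeff_zero]

/-- The invertible series `1 + X_i`. -/
def oneAddVar (i : Fin m) : (NCSeries m)ˣ where
  val := 1 + var i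
  inv := geom i
  val_inv := one_add_var_mul_geom i
  inv_val := geom_mul_one_add_var i

/-- The Magnus expansion, the homomorphism with `E(α_i) = 1 + X_i`. -/
def magnus : FreeGroup (Fin m) →* (NCSeries m)ˣ := FreeGroup.lift oneAddVar

end NCSeries

/-! ## Welded Milnor invariants -/

/-- `z` is a value of the welded Milnor invariant of `σ` for the sequence `I = j_1 … j_k i`, where
`J = j_1 … j_k`: the coefficient of `X_{j_1} ⋯ X_{j_k}` in the Magnus expansion of a word that
expresses, modulo `G_q` for some `q > k`, the `i`th preferred longitude of a diagram of `σ`. -/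
def IsMilnorInvariant {m : ℕ} (σ : WeldedStringLink m) (J : List (Fin m)) (i : Fin m) (z : ℤ) :
    Prop :=
  ∃ (D : GaussDiagram m) (q : ℕ) (w : FreeGroup (Fin m)),
    D.toLink = σ ∧ J.length < q ∧ D.IsLongitudeWord i q w ∧
      ((NCSeries.magnus w : (NCSeries m)ˣ) : NCSeries m).coeff J = z

/-!
A coloring of a diagram in a group `N` with chosen elements `x_1, …, x_m` gives every arc an element
of `N` so that the Wirtinger relations hold and the initial arc of the `j`th component has the color
`x_j`; it is a homomorphism from the group of the diagram. The argument rests on the fact that in a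
nilpotent group a coloring exists and is unique (`GaussDiagram.exists_coloring`,
`GaussDiagram.coloring_unique`): the Wirtinger relations express each color as a conjugate of some
`x_j` by other colors, and conjugators that agree modulo one term of the lower central series give
conjugates that agree modulo the next one. Hence every longitude has a color in `N`, the value at
`x_1, …, x_m` of each word that expresses it modulo a deep enough term of the lower central series
(`GaussDiagram.IsLongitudeWord.lift_eq`). The same fact, applied to the nilpotent quotients of the
group of the diagram itself, shows that such words exist (`GaussDiagram.exists_isLongitudeWord`).

A welded Reidemeister move transports colorings and changes the product of the overcrossing colors
along a component only by a power of the initial color on the left (`WeldedMove.exists_simulates`).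
A second coloring, in `ℤ`, identifies that power with the change of the writhe, so the color of the
longitude depends on the welded link only (`WeldedStringLink.longitudeIn`).

Taking for `N` the image of the free group in the units of the ring of power series truncated in
degree `k`, one finds that the Milnor invariants of length at most `k + 1` are well defined. For the
congruence, retain only the coefficients modulo `n` at monomials without repetitions that do not
contain `X_i`. There `X_i = 0`, and products of two series that involve the same `X_j` vanish, so
conjugates of `1 + X_j` have order dividing `n` and commute with each other. The `n` underpasses
made by a `V^n`-move then contribute an `n`th power equal to `1`, and a self-crossing of a component
conjugates its arcs trivially and contributes nothing to the `i`th longitude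
(`VnSvEquiv.longitudeIn_eq`).
-/

/-! ### Letters and words of a Gauss diagram -/

theorem mem_allLetters {m : ℕ} {α : Type*} {w : Fin m → List α} {a : α} :
    a ∈ allLetters w ↔ ∃ i, a ∈ w i := by
  simp [allLetters]

namespace GaussDiagram

variable {m : ℕ} (D : GaussDiagram m)

theorem word_nodup (i : Fin m) : (D.word i).Nodup :=
  (List.nodup_flatMap.1 D.nodup).1 i (List.mem_finRange i)

theorem eq_of_mem_word {i j : Fin m} {x : Letter} (hi : x ∈ D.word i) (hj : x ∈ D.word j) :
    i = j := by
  by_contra hne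
  have : Std.Symm (Function.onFun List.Disjoint D.word) := ⟨fun _ _ h => h.symm⟩
  exact (List.nodup_flatMap.1 D.nodup).2.forall (List.mem_finRange i)
    (List.mem_finRange j) hne hi hj

theorem sign_eq_of_mem {i j : Fin m} {x y : Letter} (hx : x ∈ D.word i) (hy : y ∈ D.word j)
    (h : x.crossing = y.crossing) : x.sign = y.sign :=
  D.sign_eq x (mem_allLetters.2 ⟨i, hx⟩) y (mem_allLetters.2 ⟨j, hy⟩) h

theorem eq_of_isOver_eq {i j : Fin m} {x y : Letter} (hx : x ∈ D.word i) (hy : y ∈ D.word j)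
    (h : x.crossing = y.crossing) (ho : x.isOver = y.isOver) : x = y :=
  Letter.ext h ho (D.sign_eq_of_mem hx hy h)

/-- The position of the overpass of a crossing is unique. -/
theorem position_unique {i i' : Fin m} {p q p' q' : List Letter} {x x' : Letter}
    (h : D.word i = p ++ x :: q) (h' : D.word i' = p' ++ x' :: q')
    (ho : x.isOver = x'.isOver) (hc : x.crossing = x'.crossing) : i = i' ∧ p = p' := by
  have hx : x ∈ D.word i := by simp [h]
  have hx' : x' ∈ D.word i' := by simp [h']
  obtain rfl := D.eq_of_isOver_eq hx hx' hc ho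
  obtain rfl := D.eq_of_mem_word hx hx'
  refine ⟨rfl, ?_⟩
  have hn := D.word_nodup i
  have hp : x ∉ p := by
    rw [h] at hn
    intro hm
    exact (List.nodup_append.1 hn).2.2 x hm x (by simp) rfl
  have hp' : x ∉ p' := by
    rw [h'] at hn
    intro hm
    exact (List.nodup_append.1 hn).2.2 x hm x (by simp) rfl
  rw [h] at h'
  clear h hn hx hx'
  induction p generalizing p' with
  | nil =>
    cases p' with
    | nil => rfl
    | cons b p' => simp at h'; simp [h'.1] at hp'
  | cons a p ih =>
    cases p' with
    | nil => simp at h'; simp [h'.1] at hp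
    | cons b p' =>
      simp only [List.cons_append, List.cons.injEq] at h'
      rw [h'.1, ih h'.2 (fun hm => hp (by simp [hm])) (fun hm => hp' (by simp [hm]))]

end GaussDiagram

/-! ### Colorings of a diagram in a group -/

section Coloring

variable {N : Type*} [Group N] {N' : Type*} [Group N']

/-- The contribution of a passage to the longitude, if `g c` is the color of the arc that passes
over at the crossing `c`: an overpass contributes nothing, an underpass `g c` to the power the sign
of the crossing. -/
def Letter.act (g : ℕ → N) (x : Letter) : N :=
  if x.isOver then 1 else g x.crossing ^ (x.sign : ℤ)

/-- The product of the contributions of all passages in `w`, the unframed partial longitude read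
along `w`. -/
def run (g : ℕ → N) (w : List Letter) : N := (w.map (Letter.act g)).prod

@[simp] theorem run_nil (g : ℕ → N) : run g [] = 1 := rfl

@[simp] theorem run_cons (g : ℕ → N) (x : Letter) (w : List Letter) :
    run g (x :: w) = x.act g * run g w := by simp [run]

@[simp] theorem run_append (g : ℕ → N) (u v : List Letter) :
    run g (u ++ v) = run g u * run g v := by simp [run]

@[simp] theorem act_over (g : ℕ → N) (c : ℕ) (ε : ℤˣ) : (Letter.over c ε).act g = 1 := rfl

@[simp] theorem act_under (g : ℕ → N) (c : ℕ) (ε : ℤˣ) :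
    (Letter.under c ε).act g = g c ^ (ε : ℤ) := rfl

theorem map_run (f : N →* N') (g : ℕ → N) (w : List Letter) :
    f (run g w) = run (f ∘ g) w := by
  induction w with
  | nil => simp
  | cons x w ih =>
    rw [run_cons, run_cons, map_mul, ih]
    congr 1
    unfold Letter.act
    split <;> simp

theorem run_congr {g g' : ℕ → N} {w : List Letter}
    (h : ∀ x ∈ w, g x.crossing = g' x.crossing) : run g w = run g' w := by
  unfold run
  congr 1
  refine List.map_congr_left fun x hx => ?_
  simp [Letter.act, h x hx]

theorem run_filter_underpass (g : ℕ → N) (w : List Letter) :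
    run g (w.filter (fun x => !x.isOver)) = run g w := by
  induction w with
  | nil => rfl
  | cons x w ih => cases hx : x.isOver <;> simp [Letter.act, hx, ih]

theorem run_mem {g : ℕ → N} {H : Subgroup N} (h : ∀ c, g c ∈ H) (w : List Letter) :
    run g w ∈ H := by
  refine H.list_prod_mem fun y hy => ?_
  obtain ⟨x, -, rfl⟩ := List.mem_map.1 hy
  unfold Letter.act
  split
  · exact H.one_mem
  · exact H.zpow_mem (h _) _

/-- A strand that reads `w` and starts on an arc of color `y` passes over at each crossing `c` with
the color `g c`, if its color is conjugated by the contribution of each underpass. -/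
def IsColored (g : ℕ → N) : N → List Letter → Prop
  | _, [] => True
  | y, x :: w => (x.isOver = true → g x.crossing = y) ∧
      IsColored g ((x.act g)⁻¹ * y * x.act g) w

theorem isColored_append (g : ℕ → N) (y : N) (u v : List Letter) :
    IsColored g y (u ++ v) ↔
      IsColored g y u ∧ IsColored g ((run g u)⁻¹ * y * run g u) v := by
  induction u generalizing y with
  | nil => simp [IsColored]
  | cons x u ih =>
    simp only [List.cons_append, IsColored, ih, and_assoc, run_cons, mul_inv_rev, mul_assoc]

theorem isColored_iff (g : ℕ → N) (y : N) (w : List Letter) :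
    IsColored g y w ↔ ∀ p x q, w = p ++ x :: q → x.isOver = true →
      g x.crossing = (run g p)⁻¹ * y * run g p := by
  constructor
  · rintro h p x q rfl ho
    exact ((isColored_append g y p _).1 h).2.1 ho
  · intro h
    induction w generalizing y with
    | nil => trivial
    | cons x w ih =>
      refine ⟨fun ho => by simpa using h [] x w rfl ho, ih _ fun p z q hw ho => ?_⟩
      rw [h (x :: p) z q (by simp [hw]) ho]
      simp [mul_assoc]

theorem isColored_congr {g g' : ℕ → N} {y : N} {w : List Letter}
    (h : ∀ x ∈ w, g x.crossing = g' x.crossing) : IsColored g y w ↔ IsColored g' y w := by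
  induction w generalizing y with
  | nil => rfl
  | cons x w ih =>
    have hx : x.act g = x.act g' := by simp [Letter.act, h x]
    simp only [IsColored, h x (by simp), hx, ih fun z hz => h z (by simp [hz])]

end Coloring

namespace GaussDiagram

variable {m : ℕ} (D : GaussDiagram m) {N : Type*} [Group N] {N' : Type*} [Group N']

/-- A coloring of the arcs of `D` by elements of a group that satisfies the Wirtinger relations,
with the color `x i` on the initial arc of the `i`th component. It is recorded by the color `g c` of
the arc that passes over at each crossing `c`; the values of `g` at numbers that do not name a
crossing of `D` are arbitrary. -/
def IsColoring (x : Fin m → N) (g : ℕ → N) : Prop :=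
  ∀ i, IsColored g (x i) (D.word i)

/-- The color of the preferred longitude of the `i`th component. -/
def longitudeColor (x : Fin m → N) (g : ℕ → N) (i : Fin m) : N :=
  x i ^ (-D.selfWrithe i) * run g (D.word i)

variable {D}

theorem IsColoring.map {x : Fin m → N} {g : ℕ → N} (h : D.IsColoring x g) (f : N →* N') :
    D.IsColoring (f ∘ x) (f ∘ g) := by
  intro i
  rw [isColored_iff]
  intro p y q hw ho
  have := (isColored_iff _ _ _).1 (h i) p y q hw ho
  simp [this, map_run]

variable (D)

open Classical in
/-- The color that the arc passing over at `c` should have if `g` were a coloring. Colorings are the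
fixed points of this map. -/
noncomputable def recolor (x : Fin m → N) (g : ℕ → N) (c : ℕ) : N :=
  if h : ∃ (i : Fin m) (p : List Letter), ∃ y q, D.word i = p ++ y :: q ∧ y.isOver = true ∧
      y.crossing = c then
    (run g h.choose_spec.choose)⁻¹ * x h.choose * run g h.choose_spec.choose
  else 1

theorem recolor_eq (x : Fin m → N) (g : ℕ → N) {i : Fin m} {p q : List Letter} {y : Letter}
    (hw : D.word i = p ++ y :: q) (ho : y.isOver = true) :
    D.recolor x g y.crossing = (run g p)⁻¹ * x i * run g p := by
  have h : ∃ (i : Fin m) (p : List Letter), ∃ z q, D.word i = p ++ z :: q ∧ z.isOver = true ∧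
      z.crossing = y.crossing := ⟨i, p, y, q, hw, ho, rfl⟩
  obtain ⟨y', q', hw', ho', hc'⟩ := h.choose_spec.choose_spec
  obtain ⟨h1, h2⟩ := D.position_unique hw' hw (ho'.trans ho.symm) hc'
  rw [recolor, dif_pos h, h2, h1]

/-- `c` is the name of a crossing of the diagram. -/
def HasCrossing (c : ℕ) : Prop := ∃ i, ∃ y ∈ D.word i, y.crossing = c

theorem exists_overpass {c : ℕ} (h : D.HasCrossing c) :
    ∃ i p y q, D.word i = p ++ y :: q ∧ y.isOver = true ∧ y.crossing = c := by
  obtain ⟨i, y, hy, rfl⟩ := h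
  obtain ⟨j, z, hz, ho, hc⟩ : ∃ j, ∃ z ∈ D.word j, z.isOver = true ∧ z.crossing = y.crossing := by
    cases ho : y.isOver with
    | true => exact ⟨i, y, hy, ho, rfl⟩
    | false =>
      obtain ⟨j, hj⟩ := mem_allLetters.1 (D.mate_mem y (mem_allLetters.2 ⟨i, hy⟩))
      exact ⟨j, _, hj, by simp [Letter.mate, ho], rfl⟩
  obtain ⟨p, q, hw⟩ := List.append_of_mem hz
  exact ⟨j, p, z, q, hw, ho, hc⟩

theorem isColoring_iff (x : Fin m → N) (g : ℕ → N) :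
    D.IsColoring x g ↔ ∀ c, D.HasCrossing c → g c = D.recolor x g c := by
  constructor
  · intro h c hc
    obtain ⟨i, p, y, q, hw, ho, rfl⟩ := D.exists_overpass hc
    rw [D.recolor_eq x g hw ho]
    exact (isColored_iff _ _ _).1 (h i) p y q hw ho
  · intro h i
    rw [isColored_iff]
    intro p y q hw ho
    rw [← D.recolor_eq x g hw ho]
    exact h _ ⟨i, y, by simp [hw], rfl⟩

/-- Conjugating by elements that agree modulo `H` gives the same result modulo `[H, N]`. -/
theorem _root_.conj_inv_mul_conj_mem {H : Subgroup N} {a b : N} (x : N) (h : a⁻¹ * b ∈ H) :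
    (a⁻¹ * x * a)⁻¹ * (b⁻¹ * x * b) ∈ ⁅H, (⊤ : Subgroup N)⁆ := by
  rw [Subgroup.commutator_comm]
  have := Subgroup.commutator_mem_commutator (Subgroup.mem_top ((a⁻¹ * x * a)⁻¹))
    (H.inv_mem h)
  convert this using 1
  rw [commutatorElement_def]
  group

/-- Recoloring improves congruences along the lower central series. -/
theorem recolor_congr {x : Fin m → N} {g g' : ℕ → N} {k : ℕ}
    (h : ∀ c, D.HasCrossing c → (g c)⁻¹ * g' c ∈ (⊤ : Subgroup N).lowerCentralSeries k) {c : ℕ}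
    (hc : D.HasCrossing c) :
    (D.recolor x g c)⁻¹ * D.recolor x g' c ∈ (⊤ : Subgroup N).lowerCentralSeries (k + 1) := by
  obtain ⟨i, p, y, q, hw, ho, rfl⟩ := D.exists_overpass hc
  rw [D.recolor_eq x g hw ho, D.recolor_eq x g' hw ho]
  refine conj_inv_mul_conj_mem _ (QuotientGroup.eq.1 ?_)
  have e := map_run (QuotientGroup.mk' ((⊤ : Subgroup N).lowerCentralSeries k))
  refine (e g p).trans (Eq.trans (run_congr fun z hz => ?_) (e g' p).symm)
  exact QuotientGroup.eq.2 (h _ ⟨i, z, by simp [hw, hz], rfl⟩)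

/-- In a nilpotent group a coloring is determined by its values on the initial arcs. -/
theorem coloring_unique [Group.IsNilpotent N] {x : Fin m → N} {g g' : ℕ → N}
    (h : D.IsColoring x g) (h' : D.IsColoring x g') {c : ℕ} (hc : D.HasCrossing c) :
    g c = g' c := by
  have key : ∀ k, ∀ c, D.HasCrossing c →
      (g c)⁻¹ * g' c ∈ (⊤ : Subgroup N).lowerCentralSeries k := by
    intro k
    induction k with
    | zero => intro c _; exact Subgroup.mem_top _
    | succ k ih =>
      intro c hc
      rw [(D.isColoring_iff x g).1 h c hc, (D.isColoring_iff x g').1 h' c hc]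
      exact D.recolor_congr ih hc
  obtain ⟨k, hk⟩ := Subgroup.nilpotent_iff_lowerCentralSeries.1 ‹Group.IsNilpotent N›
  have := key k c hc
  rwa [hk, Subgroup.mem_bot, inv_mul_eq_one] at this

/-- In a nilpotent group every choice of colors of the initial arcs extends to a coloring, by
elements of the subgroup that they generate. -/
theorem exists_coloring [Group.IsNilpotent N] (x : Fin m → N) :
    ∃ g, D.IsColoring x g ∧ ∀ c, g c ∈ Subgroup.closure (Set.range x) := by
  let G : ℕ → ℕ → N := fun k => (D.recolor x)^[k] 1
  have hG : ∀ k, G (k + 1) = D.recolor x (G k) := fun k => Function.iterate_succ_apply' _ _ _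
  have key : ∀ k, ∀ c, D.HasCrossing c →
      (G k c)⁻¹ * G (k + 1) c ∈ (⊤ : Subgroup N).lowerCentralSeries k := by
    intro k
    induction k with
    | zero => intro c _; exact Subgroup.mem_top _
    | succ k ih =>
      intro c hc
      rw [hG (k + 1)]
      nth_rewrite 1 [hG k]
      exact D.recolor_congr ih hc
  have hmem : ∀ k c, G k c ∈ Subgroup.closure (Set.range x) := by
    intro k
    induction k with
    | zero => intro c; exact Subgroup.one_mem _
    | succ k ih =>
      intro c
      rw [hG, recolor]
      split
      · exact Subgroup.mul_mem _ (Subgroup.mul_mem _ (Subgroup.inv_mem _ (run_mem ih _))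
          (Subgroup.subset_closure ⟨_, rfl⟩)) (run_mem ih _)
      · exact Subgroup.one_mem _
  obtain ⟨k, hk⟩ := Subgroup.nilpotent_iff_lowerCentralSeries.1 ‹Group.IsNilpotent N›
  refine ⟨G k, (D.isColoring_iff x _).2 fun c hc => ?_, hmem k⟩
  have := key k c hc
  rwa [hk, Subgroup.mem_bot, inv_mul_eq_one, hG] at this

theorem run_unique [Group.IsNilpotent N] {x : Fin m → N} {g g' : ℕ → N}
    (h : D.IsColoring x g) (h' : D.IsColoring x g') (i : Fin m) :
    run g (D.word i) = run g' (D.word i) :=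
  run_congr fun y hy => D.coloring_unique h h' ⟨i, y, hy, rfl⟩

/-! ### Colorings and homomorphisms from the link group -/

theorem length_filter_lt {i : Fin m} {pre post : List Letter} {y : Letter}
    (hw : D.word i = pre ++ y :: post) :
    (pre.filter (fun x => !x.isOver)).length < (D.underpasses i).length + 1 := by
  simp [underpasses, hw]

theorem isOverArc_unique {c : ℕ} {a b : D.Arc} (ha : D.IsOverArc c a) (hb : D.IsOverArc c b) :
    a = b := by
  obtain ⟨i, j⟩ := a
  obtain ⟨i', j'⟩ := b
  obtain ⟨ε, p, q, hw, hl⟩ := ha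
  obtain ⟨ε', p', q', hw', hl'⟩ := hb
  obtain ⟨h1, h2⟩ := D.position_unique hw hw' rfl rfl
  dsimp only at h1 hl hl'
  subst h1 h2
  congr 1
  exact Fin.ext (hl.symm.trans hl')

theorem overArc_spec (i : Fin m) (j : Fin (D.underpasses i).length) :
    D.IsOverArc ((D.underpasses i).get j).crossing (D.overArc i j) :=
  (D.exists_isOverArc i _ (List.get_mem _ _)).choose_spec

theorem run_take_underpasses (g : ℕ → N) {i : Fin m} {p q : List Letter} {y : Letter}
    (hw : D.word i = p ++ y :: q) :
    run g ((D.underpasses i).take (p.filter (fun x => !x.isOver)).length) = run g p := by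
  rw [underpasses, hw, List.filter_append, List.take_left, run_filter_underpass]

theorem act_get_underpasses (g : ℕ → N) (i : Fin m) (j : Fin (D.underpasses i).length) :
    ((D.underpasses i).get j).act g =
      g ((D.underpasses i).get j).crossing ^ (((D.underpasses i).get j).sign : ℤ) := by
  have h : (D.underpasses i).get j ∈ D.underpasses i := List.get_mem _ _
  have h2 := (List.mem_filter.1 h).2
  have h3 : ((D.underpasses i).get j).isOver = false := by simpa using h2
  rw [Letter.act, h3]
  rfl

theorem run_take_succ (g : ℕ → N) (i : Fin m) (j : Fin (D.underpasses i).length) :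
    run g ((D.underpasses i).take (j + 1)) =
      run g ((D.underpasses i).take j) * ((D.underpasses i).get j).act g := by
  rw [← List.take_concat_get' _ _ j.2, run_append]
  simp

/-- If a homomorphism from the free group on the arcs takes the value `g c` on the arc passing over
at `c`, it maps the preferred longitude to its color. -/
theorem map_longitude (θ : FreeGroup D.Arc →* N) {x : Fin m → N} {g : ℕ → N}
    (hx : ∀ i, θ (D.meridianGen i) = x i)
    (hg : ∀ c a, D.IsOverArc c a → θ (FreeGroup.of a) = g c) (i : Fin m) :
    θ (D.longitude i) = D.longitudeColor x g i := by
  rw [longitude, longitudeColor, map_mul, map_zpow, hx, map_list_prod, List.map_ofFn]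
  congr 1
  have : (⇑θ ∘ D.conjugator i) = fun j => ((D.underpasses i).get j).act g := by
    funext j
    rw [Function.comp, conjugator, map_zpow, hg _ _ (D.overArc_spec i j), act_get_underpasses]
  rw [this, ← run_filter_underpass g (D.word i)]
  change _ = ((D.underpasses i).map (Letter.act g)).prod
  conv_rhs => rw [← List.ofFn_get (D.underpasses i), List.map_ofFn]
  rfl

/-- The value of a coloring on an arc. -/
def arcColor (x : Fin m → N) (g : ℕ → N) (a : D.Arc) : N :=
  (run g ((D.underpasses a.1).take a.2))⁻¹ * x a.1 * run g ((D.underpasses a.1).take a.2)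

variable {D}

theorem IsColoring.arcColor_eq {x : Fin m → N} {g : ℕ → N} (h : D.IsColoring x g) {c : ℕ}
    {a : D.Arc} (ha : D.IsOverArc c a) : D.arcColor x g a = g c := by
  obtain ⟨ε, p, q, hw, hl⟩ := ha
  rw [arcColor, ← hl, D.run_take_underpasses g hw]
  exact ((isColored_iff _ _ _).1 (h a.1) p _ q hw rfl).symm

/-- A coloring defines a homomorphism from the link group. -/
theorem IsColoring.exists_hom {x : Fin m → N} {g : ℕ → N} (h : D.IsColoring x g) :
    ∃ φ : D.LinkGroup →* N, (∀ i, φ (PresentedGroup.mk D.relators (D.meridianGen i)) = x i) ∧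
      ∀ i, φ (PresentedGroup.mk D.relators (D.longitude i)) = D.longitudeColor x g i := by
  have hθ : ∀ c a, D.IsOverArc c a →
      FreeGroup.lift (D.arcColor x g) (FreeGroup.of a) = g c := fun c a ha => by
    rw [FreeGroup.lift_apply_of, h.arcColor_eq ha]
  have hx : ∀ i, FreeGroup.lift (D.arcColor x g) (D.meridianGen i) = x i := fun i => by
    simp [meridianGen, arcColor]
  have hrel : ∀ r ∈ D.relators, FreeGroup.lift (D.arcColor x g) r = 1 := by
    rintro r ⟨i, j, rfl⟩
    have hc : FreeGroup.lift (D.arcColor x g) (D.conjugator i j) =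
        ((D.underpasses i).get j).act g := by
      rw [conjugator, map_zpow, hθ _ _ (D.overArc_spec i j), act_get_underpasses]
    simp only [map_mul, map_inv, FreeGroup.lift_apply_of, hc]
    simp only [arcColor, Fin.val_succ, Fin.val_castSucc, run_take_succ]
    group
  refine ⟨PresentedGroup.toGroup hrel, fun i => ?_, fun i => ?_⟩
  · exact hx i
  · exact D.map_longitude _ hx hθ i

variable (D)

/-- A homomorphism from the link group comes from a coloring. -/
theorem exists_isColoring_of_hom (φ : D.LinkGroup →* N) :
    ∃ g, D.IsColoring (fun i => φ (PresentedGroup.mk D.relators (D.meridianGen i))) g ∧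
      ∀ i, φ (PresentedGroup.mk D.relators (D.longitude i)) =
        D.longitudeColor (fun i => φ (PresentedGroup.mk D.relators (D.meridianGen i))) g i := by
  classical
  let θ : FreeGroup D.Arc →* N := φ.comp (PresentedGroup.mk D.relators)
  let g : ℕ → N := fun c =>
    if h : ∃ a, D.IsOverArc c a then θ (FreeGroup.of h.choose) else 1
  have hg : ∀ c a, D.IsOverArc c a → θ (FreeGroup.of a) = g c := by
    intro c a ha
    have h : ∃ a, D.IsOverArc c a := ⟨a, ha⟩
    simp only [g, dif_pos h]
    rw [D.isOverArc_unique ha h.choose_spec]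
  refine ⟨g, fun i => (isColored_iff _ _ _).2 fun p y q hw ho => ?_,
    fun i => D.map_longitude θ (fun _ => rfl) hg i⟩
  have harc : ∀ (k : ℕ) (hk : k < (D.underpasses i).length + 1),
      θ (FreeGroup.of (⟨i, ⟨k, hk⟩⟩ : D.Arc)) =
        (run g ((D.underpasses i).take k))⁻¹ * θ (D.meridianGen i) *
          run g ((D.underpasses i).take k) := by
    intro k
    induction k with
    | zero => intro hk; simp [meridianGen]
    | succ k ih =>
      intro hk
      let j : Fin (D.underpasses i).length := ⟨k, by omega⟩
      have hr : θ ((FreeGroup.of (⟨i, j.succ⟩ : D.Arc))⁻¹ * (D.conjugator i j)⁻¹ *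
          FreeGroup.of (⟨i, j.castSucc⟩ : D.Arc) * D.conjugator i j) = 1 := by
        change φ (PresentedGroup.mk D.relators _) = 1
        rw [PresentedGroup.one_of_mem (rels := D.relators) ⟨i, j, rfl⟩, map_one]
      have hc : θ (D.conjugator i j) = ((D.underpasses i).get j).act g := by
        rw [conjugator, map_zpow, hg _ _ (D.overArc_spec i j), act_get_underpasses]
      simp only [map_mul, map_inv, hc] at hr
      have h1 : θ (FreeGroup.of (⟨i, j.castSucc⟩ : D.Arc)) = _ := ih (by omega)
      rw [h1, mul_assoc, mul_assoc, inv_mul_eq_one] at hr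
      have h2 := D.run_take_succ g i j
      change θ (FreeGroup.of (⟨i, j.succ⟩ : D.Arc)) = _
      change run g ((D.underpasses i).take (k + 1)) = run g ((D.underpasses i).take k) * _ at h2
      rw [hr, h2]
      group
  have hy : y = Letter.over y.crossing y.sign := Letter.ext rfl ho rfl
  rw [hy] at hw
  have ha : D.IsOverArc y.crossing ⟨i, ⟨_, D.length_filter_lt hw⟩⟩ := ⟨_, p, q, hw, rfl⟩
  rw [← hg _ _ ha, harc, D.run_take_underpasses g hw]
  rfl

/-- In a nilpotent group of class less than `q`, a word that expresses the longitude modulo `G_q`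
takes the value of the color of the longitude. -/
theorem IsLongitudeWord.lift_eq {D : GaussDiagram m} {i : Fin m} {q : ℕ} {w : FreeGroup (Fin m)}
    (hw : D.IsLongitudeWord i q w) (hN : (⊤ : Subgroup N).lowerCentralSeries (q - 1) = ⊥)
    {x : Fin m → N} {g : ℕ → N} (hg : D.IsColoring x g) :
    FreeGroup.lift x w = D.longitudeColor x g i := by
  obtain ⟨φ, h1, h2⟩ := hg.exists_hom
  rw [IsLongitudeWord, QuotientGroup.eq] at hw
  have h3 := Subgroup.mem_map_of_mem φ hw
  rw [Subgroup.map_lowerCentralSeries] at h3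
  have h4 := Subgroup.lowerCentralSeries_mono (q - 1)
    (le_top : (⊤ : Subgroup D.LinkGroup).map φ ≤ ⊤) h3
  simp only [hN, Subgroup.mem_bot, map_mul, map_inv, inv_mul_eq_one] at h4
  rw [h2] at h4
  rw [← h4]
  have : FreeGroup.lift x =
      (φ.comp (PresentedGroup.mk D.relators)).comp (FreeGroup.lift D.meridianGen) := by
    ext j
    simpa using (h1 j).symm
  rw [this]
  rfl

/-- Modulo each term of the lower central series, longitudes are words in the meridians of the
initial arcs. -/
theorem exists_isLongitudeWord (i : Fin m) (q : ℕ) : ∃ w, D.IsLongitudeWord i q w := by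
  let L := (⊤ : Subgroup D.LinkGroup).lowerCentralSeries (q - 1)
  let φ := QuotientGroup.mk' L
  have hL : (⊤ : Subgroup (D.LinkGroup ⧸ L)).lowerCentralSeries (q - 1) = ⊥ := by
    rw [← Subgroup.map_top_of_surjective φ (QuotientGroup.mk'_surjective L),
      ← Subgroup.map_lowerCentralSeries, Subgroup.map_eq_bot_iff, QuotientGroup.ker_mk']
  have : Group.IsNilpotent (D.LinkGroup ⧸ L) :=
    Subgroup.nilpotent_iff_lowerCentralSeries.2 ⟨_, hL⟩
  obtain ⟨g, hg, hl⟩ := D.exists_isColoring_of_hom φ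
  obtain ⟨g', hg', hmem⟩ := D.exists_coloring
    (fun i => φ (PresentedGroup.mk D.relators (D.meridianGen i)))
  have h1 : φ (PresentedGroup.mk D.relators (D.longitude i)) ∈
      Subgroup.closure (Set.range
        fun i => φ (PresentedGroup.mk D.relators (D.meridianGen i))) := by
    rw [hl, longitudeColor, D.run_unique hg hg']
    exact Subgroup.mul_mem _
      (Subgroup.zpow_mem _ (Subgroup.subset_closure (Set.mem_range_self i)) _)
      (run_mem hmem _)
  rw [← FreeGroup.range_lift_eq_closure] at h1
  obtain ⟨w, hw⟩ := h1
  refine ⟨w, Eq.trans ?_ hw⟩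
  have : FreeGroup.lift (fun i => φ (PresentedGroup.mk D.relators (D.meridianGen i))) =
      (φ.comp (PresentedGroup.mk D.relators)).comp (FreeGroup.lift D.meridianGen) := by
    ext j
    simp
  rw [this]
  rfl

end GaussDiagram

/-! ### Transport of colorings along moves -/

section Simulation

variable {N : Type*} [Group N]

/-- Whenever `g'` colors a strand that reads `w'` and starts with the color `y`, the map `g` colors
a strand that reads `w` and starts with the color `y`, and the partial longitudes agree up to a
power of `y` on the left. In particular both strands then end with the same color. -/
def Simulates (g g' : ℕ → N) (w w' : List Letter) : Prop :=
  ∀ y, IsColored g' y w' → IsColored g y w ∧ ∃ k : ℤ, run g' w' = y ^ k * run g w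

theorem Simulates.append {g g' : ℕ → N} {u v u' v' : List Letter} (hu : Simulates g g' u u')
    (hv : Simulates g g' v v') : Simulates g g' (u ++ v) (u' ++ v') := by
  intro y hy
  obtain ⟨h1, h2⟩ := (isColored_append _ _ _ _).1 hy
  obtain ⟨h3, k, hk⟩ := hu y h1
  obtain ⟨h4, l, hl⟩ := hv _ h2
  have hy' : (run g' u')⁻¹ * y * run g' u' = (run g u)⁻¹ * y * run g u := by
    rw [hk]; group
  rw [hy'] at h4 hl
  refine ⟨(isColored_append _ _ _ _).2 ⟨h3, h4⟩, k + l, ?_⟩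
  have hc : ((run g u)⁻¹ * y * run g u) ^ l = (run g u)⁻¹ * y ^ l * run g u := by
    simpa using conj_zpow (a := (run g u)⁻¹) (b := y) (i := l)
  rw [run_append, run_append, hk, hl, hc, zpow_add]
  group

theorem Simulates.congr {g g' : ℕ → N} {w : List Letter}
    (h : ∀ x ∈ w, g x.crossing = g' x.crossing) : Simulates g g' w w := fun _ hy =>
  ⟨(isColored_congr h).2 hy, 0, by rw [run_congr h]; simp⟩

theorem Simulates.fillHoles {m k : ℕ} {W : Fin m → List (Letter ⊕ Fin k)}
    {B C : Fin k → List Letter} {g g' : ℕ → N}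
    (hl : ∀ x, Sum.inl x ∈ allLetters W → g x.crossing = g' x.crossing)
    (hh : ∀ j, Simulates g g' (B j) (C j)) (i : Fin m) :
    Simulates g g' (fillHoles W B i) (fillHoles W C i) := by
  have key : ∀ w : List (Letter ⊕ Fin k), (∀ x, Sum.inl x ∈ w → g x.crossing = g' x.crossing) →
      Simulates g g' (w.flatMap (Sum.elim (fun x => [x]) B))
        (w.flatMap (Sum.elim (fun x => [x]) C)) := by
    intro w
    induction w with
    | nil => intro _; exact Simulates.congr (by simp)
    | cons a w ih =>
      intro h
      rw [List.flatMap_cons, List.flatMap_cons]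
      refine Simulates.append ?_ (ih fun x hx => h x (List.mem_cons_of_mem _ hx))
      cases a with
      | inl x => exact Simulates.congr (by simpa using h x (by simp))
      | inr j => exact hh j
  exact key (W i) fun x hx => hl x (mem_allLetters.2 ⟨i, hx⟩)

/-- Each piece inside the disk of a local move starts with a conjugate of an initial color. -/
theorem exists_isColored_hole {m k : ℕ} {W : Fin m → List (Letter ⊕ Fin k)}
    {C : Fin k → List Letter} {E : GaussDiagram m} (hw : E.word = fillHoles W C) {j : Fin k}
    (hj : Sum.inr j ∈ allLetters W) {x : Fin m → N} {g : ℕ → N} (hg : E.IsColoring x g) :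
    ∃ (i : Fin m) (u : N), IsColored g (u⁻¹ * x i * u) (C j) := by
  obtain ⟨i, hi⟩ := mem_allLetters.1 hj
  obtain ⟨p, q, hpq⟩ := List.append_of_mem hi
  have h := hg i
  rw [hw, fillHoles, hpq, List.flatMap_append, List.flatMap_cons, isColored_append,
    isColored_append] at h
  exact ⟨i, _, h.2.1⟩

end Simulation

section Freshness

variable {m k : ℕ} {W : Fin m → List (Letter ⊕ Fin k)} {C : Fin k → List Letter}

theorem mem_fillHoles {a : Letter ⊕ Fin k} {i : Fin m} (ha : a ∈ W i) {x : Letter}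
    (hx : x ∈ Sum.elim (fun x => [x]) C a) : x ∈ fillHoles W C i :=
  List.mem_flatMap.2 ⟨a, ha, hx⟩

/-- Distinct places of a diagram with holes are filled by distinct letters. -/
theorem ne_of_fillHoles {E : GaussDiagram m} (hw : E.word = fillHoles W C)
    {a b : Letter ⊕ Fin k} (ha : a ∈ allLetters W) (hb : b ∈ allLetters W) (hab : a ≠ b)
    {x y : Letter} (hx : x ∈ Sum.elim (fun x => [x]) C a)
    (hy : y ∈ Sum.elim (fun x => [x]) C b) : x ≠ y := by
  rintro rfl
  have h := E.nodup
  rw [hw, allLetters, show (fillHoles W C) = fun i => (W i).flatMap _ from rfl,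
    ← List.flatMap_assoc, List.nodup_flatMap] at h
  have : Std.Symm (Function.onFun List.Disjoint (Sum.elim (fun x => [x]) C)) :=
    ⟨fun _ _ h => h.symm⟩
  exact h.2.forall ha hb hab hx hy

/-- A crossing both of whose passages lie inside the disk of a local move is not met outside. -/
theorem crossing_ne_of_fillHoles {E : GaussDiagram m} (hw : E.word = fillHoles W C)
    {j j' : Fin k} (hj : Sum.inr j ∈ allLetters W) (hj' : Sum.inr j' ∈ allLetters W) {c : ℕ}
    {ε : ℤˣ} (ho : Letter.over c ε ∈ C j) (hu : Letter.under c ε ∈ C j') {x : Letter}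
    (hx : Sum.inl x ∈ allLetters W) : x.crossing ≠ c := by
  intro hc
  obtain ⟨i, hi⟩ := mem_allLetters.1 hx
  obtain ⟨l, hl⟩ := mem_allLetters.1 hj
  have h1 : x ∈ E.word i := by rw [hw]; exact mem_fillHoles hi (by simp)
  have h2 : Letter.over c ε ∈ E.word l := by rw [hw]; exact mem_fillHoles hl ho
  have hs : x.sign = ε := E.sign_eq_of_mem h1 h2 hc
  cases hxo : x.isOver with
  | true =>
    exact ne_of_fillHoles hw hx hj (by simp) (by simp) ho (Letter.ext hc hxo hs)
  | false =>
    exact ne_of_fillHoles hw hx hj' (by simp) (by simp) hu (Letter.ext hc hxo hs)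

/-- Overpasses on distinct pieces inside the disk of a local move belong to distinct crossings. -/
theorem over_ne_of_fillHoles {E : GaussDiagram m} (hw : E.word = fillHoles W C)
    {j j' : Fin k} (hj : Sum.inr j ∈ allLetters W) (hj' : Sum.inr j' ∈ allLetters W)
    (hne : j ≠ j') {c d : ℕ} {ε ε' : ℤˣ} (hc : Letter.over c ε ∈ C j)
    (hd : Letter.over d ε' ∈ C j') : c ≠ d := by
  rintro rfl
  obtain ⟨i, hi⟩ := mem_allLetters.1 hj
  obtain ⟨l, hl⟩ := mem_allLetters.1 hj'
  have h1 : Letter.over c ε ∈ E.word i := by rw [hw]; exact mem_fillHoles hi hc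
  have h2 : Letter.over c ε' ∈ E.word l := by rw [hw]; exact mem_fillHoles hl hd
  exact ne_of_fillHoles hw hj hj' (by simpa using hne) hc hd (E.eq_of_isOver_eq h1 h2 rfl rfl)

theorem hole_mem (hW : ∀ j : Fin k, (allLetters W).count (Sum.inr j) = 1) (j : Fin k) :
    Sum.inr j ∈ allLetters W := by
  have h : 0 < (allLetters W).count (Sum.inr j) := by rw [hW]; exact Nat.one_pos
  obtain ⟨a, ha, hb⟩ := List.countP_pos_iff.1 h
  rcases a with a | a
  · exact absurd hb Bool.false_ne_true
  · rwa [show a = j from eq_of_beq hb] at ha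

end Freshness

theorem mem_pairInOrder {s : ℤˣ} {x y z : Letter} :
    z ∈ pairInOrder s x y ↔ z = x ∨ z = y := by
  unfold pairInOrder
  split <;> simp [or_comm]

theorem isColored_pair_over {N : Type*} [Group N] {g : ℕ → N} {y : N} {s : ℤˣ} {c d : ℕ}
    {ε ε' : ℤˣ} : IsColored g y (pairInOrder s (Letter.over c ε) (Letter.over d ε')) ↔
      g c = y ∧ g d = y := by
  unfold pairInOrder
  split <;> simp [IsColored, Letter.over, Letter.act, and_comm]

theorem run_pair_over {N : Type*} [Group N] {g : ℕ → N} {s : ℤˣ} {c d : ℕ}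
    {ε ε' : ℤˣ} : run g (pairInOrder s (Letter.over c ε) (Letter.over d ε')) = 1 := by
  unfold pairInOrder
  split <;> simp

theorem isColored_pair_under {N : Type*} [Group N] {g : ℕ → N} {y : N} {s : ℤˣ} {c d : ℕ}
    {ε ε' : ℤˣ} : IsColored g y (pairInOrder s (Letter.under c ε) (Letter.under d ε')) := by
  unfold pairInOrder
  split <;> simp [IsColored, Letter.under]

/-- A coloring of the second diagram of a welded Reidemeister move gives a coloring of the first
one with the same initial colors. -/
theorem WeldedMove.exists_simulates {m : ℕ} {D E : GaussDiagram m} (h : WeldedMove D E)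
    {N : Type*} [Group N] {x : Fin m → N} {g : ℕ → N} (hg : E.IsColoring x g) :
    ∃ g', ∀ i, Simulates g' g (D.word i) (E.word i) := by
  cases h with
  | rename f h =>
    refine ⟨g ∘ f, fun i => ?_⟩
    rw [h i]
    generalize D.word i = w
    have hr : ∀ w, run g (w.map (Letter.rename f)) = run (g ∘ f) w := by
      intro w
      rw [run, run, List.map_map]
      rfl
    refine fun y hy => ⟨?_, 0, by rw [hr]; simp⟩
    induction w generalizing y with
    | nil => trivial
    | cons a w ih => exact ⟨hy.1, ih _ hy.2⟩
  | r1 c ε s h =>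
    obtain ⟨W, hW, hD, hE⟩ := h
    refine ⟨g, ?_⟩
    rw [hD, hE]
    refine Simulates.fillHoles (fun _ _ => rfl) fun j => ?_
    fin_cases j
    intro y hy
    refine ⟨trivial, (ε : ℤ), ?_⟩
    -- with either order of the passages the kink contributes the power `ε` of its own color
    have hc : g c = y := by
      rcases Int.units_eq_one_or s with rfl | rfl
      · exact hy.1 rfl
      · have h2 : g c = (g c ^ (ε : ℤ))⁻¹ * y * g c ^ (ε : ℤ) := hy.2.1 rfl
        have h3 : g c ^ (ε : ℤ) * g c = g c * g c ^ (ε : ℤ) := by group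
        rw [mul_assoc, eq_inv_mul_iff_mul_eq, h3] at h2
        exact mul_right_cancel h2
    rcases Int.units_eq_one_or s with rfl | rfl <;> simp [pairInOrder, hc]
  | r2 c d ε s h =>
    obtain ⟨W, hW, hD, hE⟩ := h
    obtain ⟨i, u, hu⟩ := exists_isColored_hole hE (hole_mem hW 0) hg
    have hcd : g c = g d := by
      simp [IsColored, Letter.over, Letter.act] at hu
      rw [hu.1, hu.2]
    refine ⟨g, ?_⟩
    rw [hD, hE]
    refine Simulates.fillHoles (fun _ _ => rfl) fun j => ?_
    fin_cases j
    · exact fun y _ => ⟨trivial, 0, by simp⟩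
    · refine fun y _ => ⟨trivial, 0, ?_⟩
      rcases Int.units_eq_one_or s with rfl | rfl <;> simp [pairInOrder, hcd]
  | r3 a b c δ τ μ β h =>
    obtain ⟨W, hW, hD, hE⟩ := h
    have h0 := hole_mem hW 0
    have h1 := hole_mem hW 1
    have h2 := hole_mem hW 2
    have hac : a ≠ c := over_ne_of_fillHoles hE h0 h1 (by decide)
      (ε := δ * β) (ε' := δ * τ) (by simp [mem_pairInOrder]) (by simp [mem_pairInOrder])
    have hbc : b ≠ c := over_ne_of_fillHoles hE h0 h1 (by decide)
      (ε := δ * μ) (ε' := δ * τ) (by simp [mem_pairInOrder]) (by simp [mem_pairInOrder])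
    have hfresh : ∀ x, Sum.inl x ∈ allLetters W → x.crossing ≠ c := fun x hx =>
      crossing_ne_of_fillHoles hE h1 h2 (ε := δ * τ) (by simp [mem_pairInOrder])
        (by simp [mem_pairInOrder]) hx
    obtain ⟨i, u, hu⟩ := exists_isColored_hole hE h0 hg
    obtain ⟨t, ht⟩ : ∃ t, t = g a := ⟨_, rfl⟩
    have htb : g b = t := by
      have := isColored_pair_over.1 hu
      rw [ht, this.1, this.2]
    -- on the two sides of the move the middle strand passes over at `c` before and after its
    -- underpass at `a`, so the color at `c` is conjugated by a power of the top color `t`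
    let e : ℤ := ((μ * (δ * β) : ℤˣ) : ℤ)
    refine ⟨Function.update g c (t ^ (-e) * g c * t ^ e), ?_⟩
    rw [hD, hE]
    refine Simulates.fillHoles (fun x hx => Function.update_of_ne (hfresh x hx) _ _) fun j => ?_
    fin_cases j
    · intro y hy
      obtain ⟨hy1, hy2⟩ := isColored_pair_over.1 hy
      refine ⟨isColored_pair_over.2 ?_, 0, ?_⟩
      · rw [Function.update_of_ne hac, Function.update_of_ne hbc]
        exact ⟨hy1, hy2⟩
      · change run g (pairInOrder _ _ _) = _ * run _ (pairInOrder _ _ _)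
        rw [run_pair_over, run_pair_over]; simp
    · intro y hy
      change IsColored g y (pairInOrder _ _ _) at hy
      change IsColored _ y (pairInOrder _ _ _) ∧
        ∃ k : ℤ, run g (pairInOrder _ _ _) = _ * run _ (pairInOrder _ _ _)
      rcases Int.units_eq_one_or μ with rfl | rfl <;> refine ⟨?_, 0, ?_⟩ <;>
        simp [pairInOrder, IsColored, Letter.over, Letter.under, Letter.act, ← ht, hac, e] at hy ⊢
      · rw [hy]
      · rw [hy]; group
    · intro y hy
      refine ⟨isColored_pair_under, 0, ?_⟩
      change run g (pairInOrder _ _ _) = _ * run _ (pairInOrder _ _ _)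
      rcases Int.units_eq_one_or δ with rfl | rfl <;>
      rcases Int.units_eq_one_or β with rfl | rfl <;>
      rcases Int.units_eq_one_or μ with rfl | rfl <;>
      rcases Int.units_eq_one_or τ with rfl | rfl <;>
      simp [pairInOrder, e, mul_assoc, *]
  | oc c d ε ε' h =>
    obtain ⟨W, hW, hD, hE⟩ := h
    refine ⟨g, ?_⟩
    rw [hD, hE]
    refine Simulates.fillHoles (fun _ _ => rfl) fun j => ?_
    fin_cases j
    intro y hy
    refine ⟨?_, 0, ?_⟩
    · simp [IsColored, Letter.over, Letter.act] at hy ⊢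
      exact hy.symm
    · simp

/-! ### The longitude of a welded string link in a nilpotent group -/

namespace GaussDiagram

variable {m : ℕ}

/-- Color all arcs of the `i`th component by `1 : ℤ` and all other arcs by `0`. The longitude without
its framing correction then has the color `selfWrithe`, since only self-crossings contribute. -/
theorem run_word_eq_selfWrithe (D : GaussDiagram m) (i : Fin m) {g : ℕ → Multiplicative ℤ}
    (hg : D.IsColoring (fun j => Multiplicative.ofAdd (if j = i then (1 : ℤ) else 0)) g) :
    run g (D.word i) = Multiplicative.ofAdd (D.selfWrithe i) := by
  have hover : ∀ j, ∀ y ∈ D.word j, y.isOver = true →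
      g y.crossing = Multiplicative.ofAdd (if j = i then (1 : ℤ) else 0) := by
    intro j y hy ho
    obtain ⟨p, q, hw⟩ := List.append_of_mem hy
    rw [(isColored_iff _ _ _).1 (hg j) p y q hw ho, mul_comm (run g p)⁻¹, inv_mul_cancel_right]
  have hact : ∀ y ∈ D.word i, y.isOver = false →
      y.act g = Multiplicative.ofAdd (if y.mate ∈ D.word i then (y.sign : ℤ) else 0) := by
    intro y hy ho
    obtain ⟨j, hj⟩ := mem_allLetters.1 (D.mate_mem y (mem_allLetters.2 ⟨i, hy⟩))
    have h1 := hover j _ hj (by simp [Letter.mate, ho])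
    have h2 : y.mate ∈ D.word i ↔ j = i :=
      ⟨fun h => D.eq_of_mem_word hj h, fun h => h ▸ hj⟩
    change g y.crossing = _ at h1
    rw [Letter.act, ho, h1, ← ofAdd_zsmul]
    by_cases hji : j = i <;> simp [h2, hji]
  have key : ∀ w : List Letter, (∀ y ∈ w, y ∈ D.word i) → run g w = Multiplicative.ofAdd
      (((w.filter (fun x => !x.isOver)).filter (fun x => x.mate ∈ D.word i)).map
        (fun x => ((x.sign : ℤˣ) : ℤ))).sum := by
    intro w
    induction w with
    | nil => intro _; rfl
    | cons y w ih =>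
      intro h
      rw [run_cons, ih fun z hz => h z (List.mem_cons_of_mem _ hz)]
      cases ho : y.isOver with
      | true => simp [Letter.act, ho]
      | false =>
        rw [hact y (h y (by simp)) ho, ← ofAdd_add]
        by_cases hm : y.mate ∈ D.word i <;> simp [ho, hm]
  exact key _ fun _ h => h

/-- Welded Reidemeister moves preserve the color of the longitude. The framing correction is dealt
with by coloring in `N × ℤ`, where the second factor counts exponents of the `i`th meridian: the
power of the meridian that appears on the left of the partial longitude is the same in both
factors. -/
theorem longitudeColor_eq_of_weldedMove {D E : GaussDiagram m} (h : WeldedMove D E)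
    {N : Type*} [Group N] [Group.IsNilpotent N] {x : Fin m → N} {g g' : ℕ → N}
    (hD : D.IsColoring x g) (hE : E.IsColoring x g') (i : Fin m) :
    D.longitudeColor x g i = E.longitudeColor x g' i := by
  have := Group.isNilpotent_prod (G₁ := N) (G₂ := Multiplicative ℤ)
  let X : Fin m → N × Multiplicative ℤ := fun j =>
    (x j, Multiplicative.ofAdd (if j = i then (1 : ℤ) else 0))
  obtain ⟨G, hG, -⟩ := E.exists_coloring X
  obtain ⟨F, hF⟩ := h.exists_simulates hG
  have hF' : D.IsColoring X F := fun j => (hF j _ (hG j)).1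
  obtain ⟨k, hk⟩ := (hF i _ (hG i)).2
  have hk1 := congrArg (MonoidHom.fst N (Multiplicative ℤ)) hk
  have hk2 := congrArg (MonoidHom.snd N (Multiplicative ℤ)) hk
  rw [map_mul, map_zpow, map_run, map_run] at hk1 hk2
  rw [E.run_word_eq_selfWrithe i (hG.map (MonoidHom.snd N (Multiplicative ℤ))),
    D.run_word_eq_selfWrithe i (hF'.map (MonoidHom.snd N (Multiplicative ℤ)))] at hk2
  rw [E.run_unique (hG.map (MonoidHom.fst N (Multiplicative ℤ))) hE,
    D.run_unique (hF'.map (MonoidHom.fst N (Multiplicative ℤ))) hD] at hk1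
  have hk3 : E.selfWrithe i = k + D.selfWrithe i := by
    have := congrArg Multiplicative.toAdd hk2
    simpa [X] using this
  rw [longitudeColor, longitudeColor, hk1, hk3]
  simp only [MonoidHom.coe_fst, X]
  group

variable {N : Type*} [Group N] [Group.IsNilpotent N]

/-- The value of the `i`th preferred longitude under the homomorphism that maps the meridian of the
`j`th initial arc to `x j`. -/
noncomputable def longitudeIn (x : Fin m → N) (i : Fin m) (D : GaussDiagram m) : N :=
  D.longitudeColor x (D.exists_coloring x).choose i

theorem longitudeIn_eq (D : GaussDiagram m) {x : Fin m → N} {g : ℕ → N} (hg : D.IsColoring x g)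
    (i : Fin m) : D.longitudeIn x i = D.longitudeColor x g i := by
  rw [longitudeIn, longitudeColor, D.run_unique (D.exists_coloring x).choose_spec.1 hg,
    longitudeColor]

end GaussDiagram

/-- The value of the `i`th preferred longitude of a welded string link in a nilpotent group with
distinguished elements `x j`. -/
noncomputable def WeldedStringLink.longitudeIn {m : ℕ} {N : Type*} [Group N] [Group.IsNilpotent N]
    (x : Fin m → N) (i : Fin m) : WeldedStringLink m → N :=
  Quot.lift (GaussDiagram.longitudeIn x i) fun D E h => by
    obtain ⟨g, hg, -⟩ := D.exists_coloring x
    obtain ⟨g', hg', -⟩ := E.exists_coloring x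
    rw [D.longitudeIn_eq hg, E.longitudeIn_eq hg',
      GaussDiagram.longitudeColor_eq_of_weldedMove h hg hg']

/-! ### `V^n`-moves and self-crossing virtualizations -/

section VnSv

variable {m : ℕ} {N : Type*} [Group N]

theorem eq_of_isColored_over {g : ℕ → N} {y : N} {w : List Letter} (h : IsColored g y w)
    (hw : ∀ x ∈ w, x.isOver = true) : ∀ x ∈ w, g x.crossing = y := by
  induction w with
  | nil => simp
  | cons a w ih =>
    have ha : a.isOver = true := hw a (by simp)
    have h2 := h.2
    rw [Letter.act, if_pos ha, inv_one, one_mul, mul_one] at h2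
    intro x hx
    rcases List.mem_cons.1 hx with rfl | hx
    · exact h.1 ha
    · exact ih h2 (fun z hz => hw z (List.mem_cons_of_mem _ hz)) x hx

theorem run_over {g : ℕ → N} {w : List Letter} (hw : ∀ x ∈ w, x.isOver = true) :
    run g w = 1 := by
  refine List.prod_eq_one fun y hy => ?_
  obtain ⟨x, hx, rfl⟩ := List.mem_map.1 hy
  rw [Letter.act, if_pos (hw x hx)]

/-- The `n` underpasses that a `V^n`-move creates contribute the `n`th power of a conjugate of a
meridian. -/
theorem VMove.simulates {n : ℕ} {D E : GaussDiagram m} (h : VMove n D E) {x : Fin m → N}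
    (hn : ∀ j, x j ^ n = 1) {g : ℕ → N} (hg : E.IsColoring x g) (i : Fin m) :
    Simulates g g (D.word i) (E.word i) := by
  obtain ⟨c, ε, W, hW, hD, hE⟩ := h
  obtain ⟨l, u, hu⟩ := exists_isColored_hole hE (hole_mem hW 0) hg
  have hover : ∀ z ∈ List.ofFn (fun t => Letter.over (c t) ε), z.isOver = true := by
    intro z hz
    obtain ⟨t, rfl⟩ := (List.mem_ofFn' _ _).1 hz
    rfl
  have hc : ∀ t, g (c t) = u⁻¹ * x l * u := fun t =>
    eq_of_isColored_over hu hover (Letter.over (c t) ε) ((List.mem_ofFn' _ _).2 ⟨t, rfl⟩)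
  rw [hD, hE]
  refine Simulates.fillHoles (fun _ _ => rfl) (fun j => ?_) i
  fin_cases j
  · refine fun y _ => ⟨trivial, 0, ?_⟩
    change run g (List.ofFn _) = _ * run g []
    rw [run_over hover]
    simp
  · refine fun y _ => ⟨trivial, 0, ?_⟩
    change run g (List.ofFn fun t => Letter.under (c t) ε) = _ * run g []
    have h1 : ∀ z ∈ (List.ofFn fun t => Letter.under (c t) ε).map (Letter.act g),
        z = (u⁻¹ * x l * u) ^ (ε : ℤ) := by
      intro z hz
      obtain ⟨a, ha, rfl⟩ := List.mem_map.1 hz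
      obtain ⟨t, rfl⟩ := (List.mem_ofFn' _ _).1 ha
      rw [act_under, hc]
    have h2 : (u⁻¹ * x l * u) ^ n = 1 := by
      have := conj_pow (a := u⁻¹) (b := x l) (i := n)
      rw [inv_inv] at this
      rw [this, hn]
      simp
    rw [run, List.prod_eq_pow_card _ _ h1, List.length_map, List.length_ofFn, ← zpow_natCast,
      zpow_comm, zpow_natCast, h2]
    simp

/-- Crossings of a component with itself can be forgotten if conjugates of the same meridian
commute. -/
theorem IsColored.filter_of_commute {g : ℕ → N} {y : N} {w : List Letter} (h : IsColored g y w)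
    {c : ℕ} (hc : ∀ u, Commute (g c) (u⁻¹ * y * u)) :
    IsColored g y (w.filter (fun x => x.crossing ≠ c)) := by
  induction w generalizing y with
  | nil => trivial
  | cons a w ih =>
    have hc' : ∀ u, Commute (g c) (u⁻¹ * ((a.act g)⁻¹ * y * a.act g) * u) := by
      intro u
      convert hc (a.act g * u) using 1
      group
    by_cases ha : a.crossing = c
    · have hcy : Commute (a.act g) y := by
        have h1 : Commute (g c) y := by simpa using hc 1
        rw [Letter.act, ha]
        split
        · exact Commute.one_left _
        · exact h1.zpow_left _
      have h2 := ih h.2 hc'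
      rw [mul_assoc, ← hcy.eq, inv_mul_cancel_left] at h2
      simpa [ha] using h2
    · rw [List.filter_cons_of_pos (by simpa using ha)]
      exact ⟨h.1, ih h.2 hc'⟩

/-- Self-crossing virtualization preserves colorings if conjugates of the same meridian commute, and
it preserves the longitude of a component whose meridian is trivial. -/
theorem SelfVirtualization.run_eq {D E : GaussDiagram m} (h : SelfVirtualization D E)
    {x : Fin m → N} (hcomm : ∀ j u, Commute (u⁻¹ * x j * u) (x j)) {i : Fin m} (hi : x i = 1)
    {g : ℕ → N} (hg : D.IsColoring x g) :
    E.IsColoring x g ∧ run g (E.word i) = run g (D.word i) := by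
  obtain ⟨l, c, ε, ho, hu, hE⟩ := h
  obtain ⟨p, q, hw⟩ := List.append_of_mem ho
  have hgc : g c = (run g p)⁻¹ * x l * run g p := (isColored_iff _ _ _).1 (hg l) p _ q hw rfl
  have hfilter : ∀ j, j ≠ l → E.word j = D.word j := by
    intro j hj
    rw [hE, List.filter_eq_self]
    intro a ha
    simp only [ne_eq, decide_not, Bool.not_eq_eq_eq_not, Bool.not_true, decide_eq_false_iff_not]
    intro hac
    have hs : a.sign = ε := D.sign_eq_of_mem ha ho hac
    cases hao : a.isOver with
    | true =>
      rw [show a = Letter.over c ε from Letter.ext hac hao hs] at ha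
      exact hj (D.eq_of_mem_word ha ho)
    | false =>
      rw [show a = Letter.under c ε from Letter.ext hac hao hs] at ha
      exact hj (D.eq_of_mem_word ha hu)
  constructor
  · intro j
    by_cases hj : j = l
    · subst hj
      rw [hE]
      refine (hg j).filter_of_commute fun u => ?_
      have h1 := (hcomm j (run g p * u⁻¹)).map (MulAut.conj u⁻¹).toMonoidHom
      rw [hgc]
      convert h1 using 1
      · simp [mul_assoc]
      · simp
    · rw [hfilter j hj]
      exact hg j
  · by_cases hil : i = l
    · subst hil
      have hc1 : g c = 1 := by rw [hgc, hi]; simp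
      rw [hE]
      generalize D.word i = w
      induction w with
      | nil => rfl
      | cons a w ih =>
        by_cases ha : a.crossing = c
        · have : a.act g = 1 := by simp [Letter.act, ha, hc1]
          simpa [ha, this] using ih
        · simpa [ha] using ih
    · rw [hfilter i hil]

/-- The longitude of a component with trivial meridian is an invariant of `(V^n + sv)`-equivalence
in every nilpotent group in which meridians have order dividing `n` and conjugates of the same
meridian commute. -/
theorem VnSvEquiv.longitudeIn_eq [Group.IsNilpotent N] {n : ℕ} {σ σ' : WeldedStringLink m}
    (h : VnSvEquiv n σ σ') {x : Fin m → N} (hn : ∀ j, x j ^ n = 1)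
    (hcomm : ∀ j u, Commute (u⁻¹ * x j * u) (x j)) {i : Fin m} (hi : x i = 1) :
    σ.longitudeIn x i = σ'.longitudeIn x i := by
  induction h with
  | refl _ => rfl
  | symm _ _ _ ih => exact ih.symm
  | trans _ _ _ _ _ ih ih' => exact ih.trans ih'
  | rel σ σ' h =>
    obtain ⟨D, E, rfl, rfl, h⟩ := h
    change D.longitudeIn x i = E.longitudeIn x i
    rcases h with h | h
    · obtain ⟨g, hg, -⟩ := E.exists_coloring x
      have hD : D.IsColoring x g := fun j => (h.simulates hn hg j _ (hg j)).1
      obtain ⟨k, hk⟩ := (h.simulates hn hg i _ (hg i)).2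
      rw [D.longitudeIn_eq hD, E.longitudeIn_eq hg]
      simp [GaussDiagram.longitudeColor, hk, hi]
    · obtain ⟨g, hg, -⟩ := D.exists_coloring x
      obtain ⟨hE, hr⟩ := h.run_eq hcomm hi hg
      rw [D.longitudeIn_eq hg, E.longitudeIn_eq hE]
      simp [GaussDiagram.longitudeColor, hr, hi]

end VnSv

/-! ### Truncated Magnus expansions -/

namespace NCSeries

variable {m : ℕ}

theorem coeff_sub (f g : NCSeries m) (J : List (Fin m)) :
    (f - g).coeff J = f.coeff J - g.coeff J := by
  rw [sub_eq_add_neg, coeff_add, coeff_neg, sub_eq_add_neg]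

/-- Congruence modulo `n` of the coefficients at the monomials in a set that contains all factors of
its members. -/
def coeffCon (S : Set (List (Fin m))) (hS : ∀ u v, u ++ v ∈ S → u ∈ S ∧ v ∈ S) (n : ℤ) :
    RingCon (NCSeries m) where
  r f g := ∀ J ∈ S, f.coeff J ≡ g.coeff J [ZMOD n]
  iseqv := ⟨fun _ _ _ => rfl, fun h J hJ => (h J hJ).symm, fun h h' J hJ =>
    (h J hJ).trans (h' J hJ)⟩
  mul' := fun {f f' g g'} h h' J hJ => by
    have key : ∀ s : Finset ℕ,
        (∑ k ∈ s, f.coeff (J.take k) * g.coeff (J.drop k)) ≡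
          ∑ k ∈ s, f'.coeff (J.take k) * g'.coeff (J.drop k) [ZMOD n] := by
      intro s
      induction s using Finset.induction_on with
      | empty => rfl
      | insert a s ha ih =>
        obtain ⟨h1, h2⟩ := hS (J.take a) (J.drop a) (by rwa [List.take_append_drop])
        rw [Finset.sum_insert ha, Finset.sum_insert ha]
        exact ((h _ h1).mul (h' _ h2)).add ih
    rw [coeff_mul, coeff_mul]
    exact key _
  add' := fun h h' J hJ => (h J hJ).add (h' J hJ)

/-- The coefficients of `f` at monomials of degree less than `d` vanish. -/
def VanishesBelow (d : ℕ) (f : NCSeries m) : Prop := ∀ J, J.length < d → f.coeff J = 0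

theorem VanishesBelow.mul {a b : ℕ} {f g : NCSeries m} (hf : VanishesBelow a f)
    (hg : VanishesBelow b g) : VanishesBelow (a + b) (f * g) := by
  intro J hJ
  rw [coeff_mul]
  refine Finset.sum_eq_zero fun k _ => ?_
  by_cases hka : (J.take k).length < a
  · rw [hf _ hka, zero_mul]
  · rw [hg, mul_zero]
    rw [List.length_take] at hka
    rw [List.length_drop]
    omega

theorem VanishesBelow.add {a : ℕ} {f g : NCSeries m} (hf : VanishesBelow a f)
    (hg : VanishesBelow a g) : VanishesBelow a (f + g) := fun J hJ => by
  rw [coeff_add, hf J hJ, hg J hJ, add_zero]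

theorem VanishesBelow.neg {a : ℕ} {f : NCSeries m} (hf : VanishesBelow a f) :
    VanishesBelow a (-f) := fun J hJ => by
  rw [coeff_neg, hf J hJ, neg_zero]

theorem vanishesBelow_zero (f : NCSeries m) : VanishesBelow 0 f := fun _ h =>
  absurd h (Nat.not_lt_zero _)

/-- The units that agree with `1` in degrees less than `d`. -/
def unitsOneBelow (d : ℕ) : Subgroup (NCSeries m)ˣ where
  carrier := {u | VanishesBelow d ((u : NCSeries m) - 1)}
  one_mem' := fun J _ => by simp [coeff_zero]
  mul_mem' := fun {u v} hu hv => by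
    change VanishesBelow d _
    have : ((u * v : (NCSeries m)ˣ) : NCSeries m) - 1 =
        ((u : NCSeries m) - 1) * v + ((v : NCSeries m) - 1) := by
      rw [Units.val_mul]; noncomm_ring
    rw [this]
    exact (VanishesBelow.mul hu (vanishesBelow_zero _)).add hv
  inv_mem' := fun {u} hu => by
    change VanishesBelow d _
    have : ((u⁻¹ : (NCSeries m)ˣ) : NCSeries m) - 1 =
        -(((u : NCSeries m) - 1) * (u⁻¹ : (NCSeries m)ˣ)) := by
      rw [sub_mul, Units.mul_inv]; noncomm_ring
    rw [this]
    exact (VanishesBelow.mul hu (vanishesBelow_zero _)).neg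

theorem commutator_unitsOneBelow_le (a b : ℕ) :
    ⁅(unitsOneBelow a : Subgroup (NCSeries m)ˣ), (unitsOneBelow b : Subgroup (NCSeries m)ˣ)⁆ ≤
      unitsOneBelow (a + b) := by
  rw [Subgroup.commutator_le]
  intro u hu v hv
  rw [commutatorElement_def]
  change VanishesBelow _ _
  have : ((u * v * u⁻¹ * v⁻¹ : (NCSeries m)ˣ) : NCSeries m) - 1 =
      (((u : NCSeries m) - 1) * ((v : NCSeries m) - 1) +
        -(((v : NCSeries m) - 1) * ((u : NCSeries m) - 1))) *
        ((u⁻¹ * v⁻¹ : (NCSeries m)ˣ) : NCSeries m) := by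
    have h : ((u : NCSeries m) - 1) * ((v : NCSeries m) - 1) +
        -(((v : NCSeries m) - 1) * ((u : NCSeries m) - 1)) =
        ((u * v : (NCSeries m)ˣ) : NCSeries m) - ((v * u : (NCSeries m)ˣ) : NCSeries m) := by
      rw [Units.val_mul, Units.val_mul]; noncomm_ring
    rw [h, sub_mul, ← Units.val_mul, ← Units.val_mul,
      show v * u * (u⁻¹ * v⁻¹) = 1 by group, Units.val_one]
    simp only [mul_assoc]
  rw [this]
  refine VanishesBelow.mul (b := 0) (VanishesBelow.add ?_ (VanishesBelow.neg ?_))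
    (vanishesBelow_zero _)
  · exact VanishesBelow.mul hu hv
  · have h := VanishesBelow.mul hv hu
    rwa [add_comm] at h

/-- Magnus' theorem: the expansions of the elements of the lower central series begin in high
degree. -/
theorem magnus_mem_unitsOneBelow (k : ℕ) {w : FreeGroup (Fin m)}
    (hw : w ∈ (⊤ : Subgroup (FreeGroup (Fin m))).lowerCentralSeries k) :
    magnus w ∈ unitsOneBelow (k + 1) := by
  have h1 : (⊤ : Subgroup (FreeGroup (Fin m))).map magnus ≤ unitsOneBelow 1 := by
    rw [← MonoidHom.range_eq_map, magnus]
    refine FreeGroup.range_lift_le ?_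
    rintro _ ⟨i, rfl⟩ J hJ
    obtain rfl : J = [] := List.length_eq_zero_iff.1 (by omega)
    simp [oneAddVar, var]
  have key : ∀ k, ((⊤ : Subgroup (FreeGroup (Fin m))).map magnus).lowerCentralSeries k ≤
      unitsOneBelow (k + 1) := by
    intro k
    induction k with
    | zero => exact h1
    | succ k ih => exact (Subgroup.commutator_mono ih h1).trans (commutator_unitsOneBelow_le _ _)
  refine key k ?_
  rw [← Subgroup.map_lowerCentralSeries]
  exact Subgroup.mem_map_of_mem _ hw

/-- Every monomial of `f` with a nonzero coefficient contains `X_j`. -/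
def Involves (j : Fin m) (f : NCSeries m) : Prop := ∀ J, j ∉ J → f.coeff J = 0

theorem involves_var (j : Fin m) : Involves j (var j) := by
  intro J hJ
  have : J ≠ [j] := by rintro rfl; simp at hJ
  simp [var, this]

theorem Involves.mul_left {j : Fin m} {f : NCSeries m} (hf : Involves j f) (g : NCSeries m) :
    Involves j (g * f) := fun J hJ => by
  rw [coeff_mul]
  refine Finset.sum_eq_zero fun k _ => ?_
  rw [hf _ fun h => hJ (List.mem_of_mem_drop h), mul_zero]

theorem Involves.mul_right {j : Fin m} {f : NCSeries m} (hf : Involves j f) (g : NCSeries m) :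
    Involves j (f * g) := fun J hJ => by
  rw [coeff_mul]
  refine Finset.sum_eq_zero fun k _ => ?_
  rw [hf _ fun h => hJ (List.mem_of_mem_take h), zero_mul]

/-- A product of two series that involve `X_j` has only monomials with repeated variables. -/
theorem Involves.coeff_mul_eq_zero {j : Fin m} {f g : NCSeries m} (hf : Involves j f)
    (hg : Involves j g) {J : List (Fin m)} (hJ : J.Nodup) : (f * g).coeff J = 0 := by
  rw [coeff_mul]
  refine Finset.sum_eq_zero fun k _ => ?_
  by_cases h1 : j ∈ J.take k
  · rw [hg, mul_zero]
    intro h2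
    exact List.disjoint_take_drop hJ le_rfl h1 h2
  · rw [hf _ h1, zero_mul]

section Truncation

variable (S : Set (List (Fin m))) (hS : ∀ u v, u ++ v ∈ S → u ∈ S ∧ v ∈ S) (n : ℤ)

/-- The Magnus expansion, with only the coefficients at the monomials in `S` retained, modulo
`n`. -/
def truncMagnus : FreeGroup (Fin m) →* (coeffCon S hS n).Quotientˣ :=
  (Units.map ((coeffCon S hS n).mk' : NCSeries m →* (coeffCon S hS n).Quotient)).comp magnus

theorem truncMagnus_eq_iff {v w : FreeGroup (Fin m)} :
    truncMagnus S hS n v = truncMagnus S hS n w ↔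
      ∀ J ∈ S, (magnus v : NCSeries m).coeff J ≡ (magnus w : NCSeries m).coeff J [ZMOD n] := by
  rw [Units.ext_iff]
  exact RingCon.eq _

/-- The images of the generators in the image of the truncated Magnus expansion. -/
def truncGen (j : Fin m) : (truncMagnus S hS n).range :=
  (truncMagnus S hS n).rangeRestrict (FreeGroup.of j)

theorem lift_truncGen (w : FreeGroup (Fin m)) :
    FreeGroup.lift (truncGen S hS n) w = (truncMagnus S hS n).rangeRestrict w := by
  have : FreeGroup.lift (truncGen S hS n) = (truncMagnus S hS n).rangeRestrict := by
    ext j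
    simp [truncGen]
  rw [this]

/-- The image of the free group is nilpotent if the retained monomials have bounded degree. -/
theorem lowerCentralSeries_truncMagnus {k : ℕ} (hk : ∀ J ∈ S, J.length ≤ k) :
    (⊤ : Subgroup (truncMagnus S hS n).range).lowerCentralSeries k = ⊥ := by
  rw [← Subgroup.map_top_of_surjective _ (truncMagnus S hS n).rangeRestrict_surjective,
    ← Subgroup.map_lowerCentralSeries, Subgroup.map_eq_bot_iff]
  intro w hw
  rw [MonoidHom.ker_rangeRestrict, MonoidHom.mem_ker, ← map_one (truncMagnus S hS n),
    truncMagnus_eq_iff]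
  intro J hJ
  have h := magnus_mem_unitsOneBelow k hw J (Nat.lt_succ_of_le (hk J hJ))
  rw [coeff_sub, sub_eq_zero] at h
  rw [h, map_one, Units.val_one]

theorem magnus_of (j : Fin m) : ((magnus (FreeGroup.of j) : (NCSeries m)ˣ) : NCSeries m) =
    1 + var j := by
  simp [magnus, oneAddVar]

theorem truncGen_eq_one {i : Fin m} (hi : ∀ J ∈ S, i ∉ J) : truncGen S hS n i = 1 := by
  rw [truncGen, ← map_one (truncMagnus S hS n).rangeRestrict, Subtype.ext_iff]
  refine (truncMagnus_eq_iff S hS n).2 fun J hJ => ?_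
  rw [magnus_of, map_one, Units.val_one, coeff_add, involves_var i J (hi J hJ), add_zero]

/-- If only monomials without repeated variables are retained, conjugates of a generator commute
with it: up to `1` all of them involve the same variable. -/
theorem commute_truncGen (hnd : ∀ J ∈ S, J.Nodup) (j : Fin m) (u : (truncMagnus S hS n).range) :
    Commute (u⁻¹ * truncGen S hS n j * u) (truncGen S hS n j) := by
  obtain ⟨w, rfl⟩ := (truncMagnus S hS n).rangeRestrict_surjective u
  rw [truncGen, Commute, SemiconjBy, ← map_inv, ← map_mul, ← map_mul, ← map_mul, ← map_mul,
    Subtype.ext_iff]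
  refine (truncMagnus_eq_iff S hS n).2 fun J hJ => ?_
  set U : NCSeries m := ((magnus w : (NCSeries m)ˣ) : NCSeries m)
  set V : NCSeries m := ((magnus w⁻¹ : (NCSeries m)ˣ) : NCSeries m)
  have hVU : V * U = 1 := by
    rw [← Units.val_mul, ← map_mul, inv_mul_cancel, map_one, Units.val_one]
  have h1 : V * (1 + var j) * U = 1 + V * var j * U := by
    rw [mul_add, add_mul, mul_one, hVU]
  have hV : Involves j (V * var j * U) := ((involves_var j).mul_left V).mul_right U
  simp only [map_mul, Units.val_mul, magnus_of]
  change ((V * (1 + var j) * U) * (1 + var j)).coeff J ≡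
    ((1 + var j) * (V * (1 + var j) * U)).coeff J [ZMOD n]
  rw [h1]
  simp only [mul_add, add_mul, mul_one, one_mul, coeff_add,
    hV.coeff_mul_eq_zero (involves_var j) (hnd J hJ),
    (involves_var j).coeff_mul_eq_zero hV (hnd J hJ)]
  rw [add_zero, add_zero, add_right_comm]

end Truncation

theorem coeff_one_add_var_pow (j : Fin m) (k : ℕ) {J : List (Fin m)} (hJ : J.Nodup) :
    ((1 + var j) ^ k).coeff J = (1 : NCSeries m).coeff J + k * (var j).coeff J := by
  induction k generalizing J with
  | zero => simp
  | succ k ih =>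
    have h : ((1 + var j) ^ k * var j).coeff J = (var j).coeff J := by
      have : ∀ k : ℕ, ((1 + var j) ^ k * var j).coeff J = (var j).coeff J := by
        intro k
        induction k with
        | zero => simp
        | succ k ih' =>
          rw [pow_succ, mul_assoc, add_mul, one_mul, mul_add, coeff_add, ih', ← mul_assoc,
            ((involves_var j).mul_left _).coeff_mul_eq_zero (involves_var j) hJ, add_zero]
      exact this k
    rw [pow_succ, mul_add, mul_one, coeff_add, ih hJ, h]
    push_cast
    ring

theorem truncGen_pow (S : Set (List (Fin m))) (hS : ∀ u v, u ++ v ∈ S → u ∈ S ∧ v ∈ S) (n : ℕ)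
    (hnd : ∀ J ∈ S, J.Nodup) (j : Fin m) : truncGen S hS n j ^ n = 1 := by
  rw [truncGen, ← map_pow, ← map_one (truncMagnus S hS n).rangeRestrict, Subtype.ext_iff]
  refine (truncMagnus_eq_iff S hS n).2 fun J hJ => ?_
  rw [map_pow, Units.val_pow_eq_pow_val, magnus_of, coeff_one_add_var_pow j n (hnd J hJ),
    map_one, Units.val_one]
  exact (Int.modEq_iff_dvd.2 (by simp)).symm

end NCSeries

/-! ### Milnor invariants -/

open NCSeries in
/-- A word for the longitude of a diagram of `σ` determines the value of the longitude of `σ` in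
each truncation of sufficiently small degree. -/
theorem GaussDiagram.IsLongitudeWord.truncMagnus_eq {m : ℕ} {D : GaussDiagram m} {i : Fin m}
    {q : ℕ} {w : FreeGroup (Fin m)} (hw : D.IsLongitudeWord i q w) {S : Set (List (Fin m))}
    {hS : ∀ u v, u ++ v ∈ S → u ∈ S ∧ v ∈ S} {n : ℤ} (hq : ∀ J ∈ S, J.length ≤ q - 1)
    [Group.IsNilpotent (truncMagnus S hS n).range] :
    (truncMagnus S hS n).rangeRestrict w = D.toLink.longitudeIn (truncGen S hS n) i := by
  obtain ⟨g, hg, -⟩ := D.exists_coloring (truncGen S hS n)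
  rw [← lift_truncGen, hw.lift_eq (lowerCentralSeries_truncMagnus S hS n hq) hg]
  exact (D.longitudeIn_eq hg i).symm

open NCSeries in
/-- The Milnor invariants are well defined: the coefficients of degree at most `k` of the longitude
are determined by its value in the truncation at degree `k`. -/
theorem isMilnorInvariant_iff {m : ℕ} {D : GaussDiagram m} {i : Fin m} {q : ℕ}
    {w : FreeGroup (Fin m)} (hw : D.IsLongitudeWord i q w) {J : List (Fin m)} (hq : J.length < q)
    (y : ℤ) : IsMilnorInvariant D.toLink J i y ↔
      y = ((magnus w : (NCSeries m)ˣ) : NCSeries m).coeff J := by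
  constructor
  · rintro ⟨D', q', w', hD', hq', hw', rfl⟩
    let S : Set (List (Fin m)) := {L | L.length ≤ J.length}
    have hS : ∀ u v, u ++ v ∈ S → u ∈ S ∧ v ∈ S := by
      intro u v h
      simp only [S, Set.mem_ofPred_eq, List.length_append] at h ⊢
      omega
    have := Subgroup.nilpotent_iff_lowerCentralSeries.2
      ⟨_, lowerCentralSeries_truncMagnus S hS 0 (k := J.length) fun _ h => h⟩
    have h1 := hw.truncMagnus_eq (S := S) (hS := hS) (n := 0)
      fun L (hL : L.length ≤ J.length) => by omega
    have h2 := hw'.truncMagnus_eq (S := S) (hS := hS) (n := 0)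
      fun L (hL : L.length ≤ J.length) => by omega
    rw [hD', ← h1, Subtype.ext_iff] at h2
    exact Int.modEq_zero_iff.1 ((truncMagnus_eq_iff S hS 0).1 h2 J (le_refl J.length))
  · rintro rfl
    exact ⟨D, q, w, rfl, hq, hw, rfl⟩

theorem theorem3p1 (m n : ℕ) (hn : 0 < n) (σ σ' : WeldedStringLink m) (h : VnSvEquiv n σ σ')
    (J : List (Fin m)) (i : Fin m) (hI : (J ++ [i]).Nodup) :
    ∃ z z' : ℤ,
      (∀ y : ℤ, IsMilnorInvariant σ J i y ↔ y = z) ∧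
      (∀ y : ℤ, IsMilnorInvariant σ' J i y ↔ y = z') ∧
      z ≡ z' [ZMOD (n : ℤ)] := by
  obtain ⟨D, rfl⟩ := Quot.exists_rep σ
  obtain ⟨D', rfl⟩ := Quot.exists_rep σ'
  obtain ⟨w, hw⟩ := D.exists_isLongitudeWord i (J.length + m + 1)
  obtain ⟨w', hw'⟩ := D'.exists_isLongitudeWord i (J.length + m + 1)
  refine ⟨_, _, isMilnorInvariant_iff hw (by omega), isMilnorInvariant_iff hw' (by omega), ?_⟩
  let S : Set (List (Fin m)) := {L | L.Nodup ∧ i ∉ L}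
  have hS : ∀ u v, u ++ v ∈ S → u ∈ S ∧ v ∈ S := by
    rintro u v ⟨h1, h2⟩
    rw [List.mem_append, not_or] at h2
    exact ⟨⟨h1.of_append_left, h2.1⟩, ⟨h1.of_append_right, h2.2⟩⟩
  have hlen : ∀ L ∈ S, L.length ≤ m := fun L hL => by simpa using hL.1.length_le_card
  have hlen' : ∀ L ∈ S, L.length ≤ J.length + m + 1 - 1 := fun L hL => by
    have := hlen L hL
    omega
  have := Subgroup.nilpotent_iff_lowerCentralSeries.2
    ⟨_, NCSeries.lowerCentralSeries_truncMagnus S hS n hlen⟩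
  have h1 := hw.truncMagnus_eq (S := S) (hS := hS) (n := n) hlen'
  have h2 := hw'.truncMagnus_eq (S := S) (hS := hS) (n := n) hlen'
  have h3 := h.longitudeIn_eq (x := NCSeries.truncGen S hS n)
    (NCSeries.truncGen_pow S hS n fun L hL => hL.1)
    (NCSeries.commute_truncGen S hS n fun L hL => hL.1)
    (NCSeries.truncGen_eq_one S hS n (i := i) fun L hL => hL.2)
  have h4 := h1.trans (h3.trans h2.symm)
  rw [Subtype.ext_iff] at h4
  refine (NCSeries.truncMagnus_eq_iff S hS n).1 h4 J ?_
  rw [List.nodup_append] at hI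
  exact ⟨hI.1, fun hi => hI.2.2 i hi i (by simp) rfl⟩
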